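/- **Setting.** Let $1\le m<d$ be integers and let $\mathbb V_m(\mathbb R^d)=\{\mathbf V\in\mathbb R^{d\times m}:\mathbf V^\top\mathbf V=\mathbb I_m\}$. Let $\pi$ be a probability measure on $\mathbb R^d$ with density $e^{-U}$, where $U:\mathbb R^d\to\mathbb R$ is twice continuously differentiable, $\nabla U$ is $L$-Lipschitz, and $U-\frac\lambda2\|\cdot\|^2$ is convex, with $\lambda>0$. Let $\nu$ be a probability measure on $\mathbb V_m(\mathbb R^d)$ with $\frac dm\,\mathbb E_{\mathbf V\sim\nu}[\mathbf V\mathbf V^\top]=\mathbb I_d$ and such that, $\nu$-almost surely, every column of $\mathbf V$ is an element of the canonical basis of $\mathbb R^d$. For $\sigma>0$ let $P_\sigma$ be the transition kernel of the naive zeroth-order Metropolis-adjusted Langevin algorithm: from $x$, draw $\mathbf V\sim\nu$, draw $y\sim Q_{\mathbf V}(x,\cdot)=N_d\big(x-\frac{\sigma^2}{2}\frac dm\mathbf V\mathbf V^\top\nabla U(x),\,\sigma^2\mathbb I_d\big)$, move to $y$ with probability $\min\big(1,\frac{\pi(dy)Q_{\mathbf V}(y,dx)}{\pi(dx)Q_{\mathbf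 V}(x,dy)}\big)$ and stay at $x$ otherwise. The right spectral gap of a kernel $P$ is $$\mathrm{Gap}_{P}=\inf_{f\in L^2(\pi),\ \mathrm{Var}_\pi(f)>0}\frac{\int\!\!\int (f(x)-f(y))^2\,\pi(dx)P(x,dy)}{2\,\mathrm{Var}_\pi(f)} .$$ **Theorem.** Fix $L$, $\lambda>0$ and $c_0\in(0,1)$. As $d\to\infty$ with $m<c_0d$, $$\sup_{\sigma>0}\mathrm{Gap}_{P_\sigma}=O\Big(\frac{\log(d-m)^2}{d-m}\Big)=O\Big(\frac{\log(d)^2}{d}\Big).$$ That is, there are $C>0$ and $d_0$, depending only on $L,\lambda,c_0$, such that for all $d\ge d_0$, all $m<c_0d$, and all $U,\pi,\nu$ as above, $\sup_{\sigma>0}\mathrm{Gap}_{P_\sigma}\le C\log(d-m)^2/(d-m)$ and $\sup_{\sigma>0}\mathrm{Gap}_{P_\sigma}\le C\log(d)^2/d$. -/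

import Mathlib

open MeasureTheory ProbabilityTheory
open scoped NNReal ENNReal Matrix

noncomputable section

namespace ZOMala

/-- `ℝ^d` with its Euclidean norm. -/
abbrev E (d : ℕ) : Type := EuclideanSpace ℝ (Fin d)

/-- The product (equivalently, Borel) σ-algebra on real `d × m` matrices. -/
instance matrixMeasurableSpace (d m : ℕ) : MeasurableSpace (Matrix (Fin d) (Fin m) ℝ) :=
  inferInstanceAs (MeasurableSpace (Fin d → Fin m → ℝ))

/-- The Stiefel manifold of real `d × m` matrices with orthonormal columns. -/
abbrev Stiefel (d m : ℕ) : Type := {V : Matrix (Fin d) (Fin m) ℝ // Vᵀ * V = 1}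

/-- The (probability) measure `π` has Lebesgue density `exp (-U)`, where `U` is twice continuously differentiable,
`L`-smooth and `lam`-convex. -/
structure IsTarget {d : ℕ} (L : ℝ≥0) (lam : ℝ) (U : E d → ℝ) (π : Measure (E d)) : Prop where
  density : π = volume.withDensity fun x => ENNReal.ofReal (Real.exp (-U x))
  smooth : LipschitzWith L (gradient U)
  convex : ConvexOn ℝ Set.univ fun x => U x - lam / 2 * ‖x‖ ^ 2
  contDiff : ContDiff ℝ 2 U

/-- The distribution `ν` of the directions satisfies `(d/m) 𝔼[V Vᵀ] = I_d`. -/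
def IsIsotropic {d m : ℕ} (ν : Measure (Stiefel d m)) : Prop :=
  ∀ i j, ((d : ℝ) / m) * ∫ V, (V.1 * V.1ᵀ) i j ∂ν = (1 : Matrix (Fin d) (Fin d) ℝ) i j

/-- Almost surely, every column of `V` is a vector of the canonical basis. -/
def CanonicalColumns {d m : ℕ} (ν : Measure (Stiefel d m)) : Prop :=
  ∀ᵐ V ∂ν, ∀ j : Fin m, ∃ i : Fin d, V.1.col j = Pi.single i 1

variable {d m : ℕ}

/-- The gradient estimator `(d/m) V Vᵀ ∇U(x)`. -/
def gradEst (U : E d → ℝ) (V : Stiefel d m) (x : E d) : E d :=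
  ((d : ℝ) / m) • WithLp.toLp 2 ((V.1 * V.1ᵀ) *ᵥ (gradient U x).ofLp)

/-- The Lebesgue density at `y` of `N_d(x - (σ²/2) (d/m) V Vᵀ ∇U(x), σ² I_d)`. -/
def propDensity (U : E d → ℝ) (σ : ℝ) (V : Stiefel d m) (x y : E d) : ℝ :=
  (√(2 * Real.pi * σ ^ 2) ^ d)⁻¹ *
    Real.exp (-‖y - (x - (σ ^ 2 / 2) • gradEst U V x)‖ ^ 2 / (2 * σ ^ 2))

/-- The proposal distribution `Q_V(x, ·)`. -/
def proposal (U : E d → ℝ) (σ : ℝ) (V : Stiefel d m) (x : E d) : Measure (E d) :=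
  volume.withDensity fun y => ENNReal.ofReal (propDensity U σ V x y)

/-- The Metropolis-Hastings acceptance probability
`min (1, π(dy) Q_V(y, dx) / (π(dx) Q_V(x, dy)))`. -/
def acceptProb (U : E d → ℝ) (σ : ℝ) (V : Stiefel d m) (x y : E d) : ℝ :=
  min 1 ((Real.exp (-U y) * propDensity U σ V y x) / (Real.exp (-U x) * propDensity U σ V x y))

/-- One Metropolis-Hastings step from `x` given the directions `V`: propose `y ∼ Q_V(x, ·)`,
move to `y` with probability `acceptProb`, and stay at `x` otherwise. -/
def mhStep (U : E d → ℝ) (σ : ℝ) (V : Stiefel d m) (x : E d) : Measure (E d) :=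
  (proposal U σ V x).withDensity (fun y => ENNReal.ofReal (acceptProb U σ V x y)) +
    (∫⁻ y, ENNReal.ofReal (1 - acceptProb U σ V x y) ∂proposal U σ V x) • Measure.dirac x

lemma measurable_gradEst {U : E d → ℝ} (hU : ContDiff ℝ 2 U) :
    Measurable fun p : E d × Stiefel d m => gradEst U p.2 p.1 := by
  have hg : Measurable (gradient U) := by
    unfold gradient
    exact ((InnerProductSpace.toDual ℝ (E d)).symm.continuous.comp
      (hU.continuous_fderiv (by norm_num))).measurable
  have hV : ∀ i k, Measurable fun p : E d × Stiefel d m => p.2.1 i k := fun i k =>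
    (measurable_pi_apply k).comp ((measurable_pi_apply i).comp
      (measurable_subtype_coe.comp measurable_snd))
  have hx : ∀ i, Measurable fun p : E d × Stiefel d m => (gradient U p.1).ofLp i := fun i =>
    (measurable_pi_apply (X := fun _ : Fin d => ℝ) i).comp
      ((WithLp.measurable_ofLp 2 (Fin d → ℝ)).comp (hg.comp measurable_fst))
  have hw : Measurable fun p : E d × Stiefel d m =>
      (p.2.1 * p.2.1ᵀ) *ᵥ (gradient U p.1).ofLp := by
    refine measurable_pi_lambda _ fun i => ?_
    simp only [Matrix.mulVec, dotProduct, Matrix.mul_apply, Matrix.transpose_apply]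
    exact Finset.measurable_sum _ fun j _ =>
      (Finset.measurable_sum _ fun k _ => (hV i k).mul (hV j k)).mul (hx j)
  exact ((WithLp.measurable_toLp 2 (Fin d → ℝ)).comp hw).const_smul ((d : ℝ) / m)

lemma measurable_propDensity {U : E d → ℝ} (hU : ContDiff ℝ 2 U) (σ : ℝ) :
    Measurable fun q : (E d × Stiefel d m) × E d => propDensity U σ q.1.2 q.1.1 q.2 := by
  have h : Measurable fun q : (E d × Stiefel d m) × E d => gradEst U q.1.2 q.1.1 :=
    (measurable_gradEst (m := m) hU).comp measurable_fst
  unfold propDensity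
  fun_prop

lemma measurable_acceptProb {U : E d → ℝ} (hU : ContDiff ℝ 2 U) (σ : ℝ) :
    Measurable fun q : (E d × Stiefel d m) × E d => acceptProb U σ q.1.2 q.1.1 q.2 := by
  have h := measurable_propDensity (m := m) hU σ
  have h' : Measurable fun q : (E d × Stiefel d m) × E d => propDensity U σ q.1.2 q.2 q.1.1 :=
    h.comp (f := fun q : (E d × Stiefel d m) × E d => ((q.2, q.1.2), q.1.1)) (by fun_prop)
  have hm : Measurable U := hU.continuous.measurable
  unfold acceptProb
  fun_prop

lemma measurable_mhStep {U : E d → ℝ} (hU : ContDiff ℝ 2 U) (σ : ℝ) :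
    Measurable fun p : E d × Stiefel d m => mhStep U σ p.2 p.1 := by
  have hq := measurable_propDensity (m := m) hU σ
  have ha := measurable_acceptProb (m := m) hU σ
  refine Measure.measurable_of_measurable_coe _ fun s hs => ?_
  have hq1 : ∀ p : E d × Stiefel d m,
      Measurable fun y => ENNReal.ofReal (propDensity U σ p.2 p.1 y) :=
    fun p => (hq.comp measurable_prodMk_left).ennreal_ofReal
  have ha1 : ∀ p : E d × Stiefel d m, Measurable fun y => acceptProb U σ p.2 p.1 y :=
    fun p => ha.comp measurable_prodMk_left
  have key : ∀ p : E d × Stiefel d m, mhStep U σ p.2 p.1 s =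
      (∫⁻ y, s.indicator 1 y * (ENNReal.ofReal (propDensity U σ p.2 p.1 y) *
        ENNReal.ofReal (acceptProb U σ p.2 p.1 y))) +
      (∫⁻ y, ENNReal.ofReal (propDensity U σ p.2 p.1 y) *
        ENNReal.ofReal (1 - acceptProb U σ p.2 p.1 y)) * s.indicator 1 p.1 := by
    intro p
    have e1 : (proposal U σ p.2 p.1).withDensity
        (fun y => ENNReal.ofReal (acceptProb U σ p.2 p.1 y)) s =
        ∫⁻ y, s.indicator 1 y * (ENNReal.ofReal (propDensity U σ p.2 p.1 y) *
          ENNReal.ofReal (acceptProb U σ p.2 p.1 y)) := by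
      rw [withDensity_apply _ hs, ← lintegral_indicator hs, proposal,
        lintegral_withDensity_eq_lintegral_mul _ (hq1 p) ((ha1 p).ennreal_ofReal.indicator hs)]
      refine lintegral_congr fun y => ?_
      by_cases hy : y ∈ s <;> simp [hy]
    have e2 : ∫⁻ y, ENNReal.ofReal (1 - acceptProb U σ p.2 p.1 y) ∂proposal U σ p.2 p.1 =
        ∫⁻ y, ENNReal.ofReal (propDensity U σ p.2 p.1 y) *
          ENNReal.ofReal (1 - acceptProb U σ p.2 p.1 y) := by
      rw [proposal, lintegral_withDensity_eq_lintegral_mul _ (hq1 p)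
        ((ha1 p).const_sub 1).ennreal_ofReal]
      rfl
    rw [mhStep, Measure.add_apply, Measure.smul_apply, smul_eq_mul, Measure.dirac_apply' _ hs,
      e1, e2]
  simp only [key]
  refine Measurable.add ?_ (Measurable.mul ?_ ?_)
  · exact Measurable.lintegral_prod_right (((measurable_one.indicator hs).comp measurable_snd).mul
      (hq.ennreal_ofReal.mul ha.ennreal_ofReal))
  · exact Measurable.lintegral_prod_right (hq.ennreal_ofReal.mul (ha.const_sub 1).ennreal_ofReal)
  · exact (measurable_one.indicator hs).comp measurable_fst

/-- The transition kernel of the naive zeroth-order MALA: draw `V ∼ ν`, then perform one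
Metropolis-Hastings step with the directions `V`. -/
def smala {U : E d → ℝ} (hU : ContDiff ℝ 2 U) (ν : Measure (Stiefel d m)) [SFinite ν] (σ : ℝ) :
    Kernel (E d) (E d) where
  toFun x := ν.bind fun V => mhStep U σ V x
  measurable' := by
    refine Measure.measurable_of_measurable_coe _ fun s hs => ?_
    have h := measurable_mhStep (m := m) hU σ
    have hb : ∀ x : E d, ν.bind (fun V => mhStep U σ V x) s = ∫⁻ V, mhStep U σ V x s ∂ν :=
      fun x => Measure.bind_apply hs (h.comp measurable_prodMk_left).aemeasurable
    simp only [hb]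
    exact Measurable.lintegral_prod_right ((Measure.measurable_coe hs).comp h)

/-- The right spectral gap of a transition kernel `P` with respect to `π`: the infimum of
`∫∫ (f x - f y)² π(dx) P(x, dy) / (2 Var_π f)` over the `f ∈ L²(π)` with non-zero variance. -/
def rightGap (π : Measure (E d)) (P : Kernel (E d) (E d)) : ℝ≥0∞ :=
  ⨅ (f : E d → ℝ) (_ : MemLp f 2 π) (_ : 0 < variance f π),
    (∫⁻ x, ∫⁻ y, ENNReal.ofReal ((f x - f y) ^ 2) ∂P x ∂π) / ENNReal.ofReal (2 * variance f π)

end ZOMala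

end

open ZOMala

open MeasureTheory ProbabilityTheory
open scoped NNReal ENNReal Matrix

noncomputable section

namespace ZOMala

variable {d m : ℕ}

/-! Two test-function bounds compete, and no step size escapes both. Put `κ = 1 - c₀` and let `a`
minimise `U`.

Large steps are rejected. At least `d - m ≥ κ d` coordinates are untouched by `V`; on these the
proposal is a driftless random walk, which tends to increase the squared distance to `a` by about
`σ²` per coordinate. The accepted flow `min (π(x) q(x,y), π(y) q(y,x))` is symmetric, and either `x
→ y` or `y → x` does not increase that distance, so the mean acceptance rate is at most twice the
Laplace transform of the increase under the unaccepted flow. Exact Gaussian tilting and the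
concentration of `π` around `a` bound it by an exponential in `-κ d w / 4`, where `w` is of order
`σ²` for small `σ` (`lintegral_acceptProb_le`). The indicator of a ball of mass one half turns this
into a bound on the gap (`rightGap_smala_le_exp`).

Small steps move little. Smoothness bounds the variance of every coordinate from below, so testing
with all coordinate functions and summing bounds the gap by the mean squared displacement per
coordinate. Replacing the gradient by its estimator inflates its second moment by `d / m ≤ d`,
whence a bound of order `σ² + σ⁴ d` (`rightGap_smala_le_sq`).

The first bound is `O(1/d)` unless `σ²` is `O(log d / d)`, and then the second is `O(log² d / d)`,
the squared logarithm coming from `σ⁴ d`. -/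

/-! ### Gaussian proposals: product form, tilting and second moment. -/

lemma lintegral_prod_gaussianPDFReal (μ : Fin d → ℝ) (v : Fin d → ℝ≥0) (hv : ∀ i, v i ≠ 0) :
    ∫⁻ y : E d, ENNReal.ofReal (∏ i, gaussianPDFReal (μ i) (v i) (y i)) = 1 := by
  have hm : Measurable fun y : Fin d → ℝ =>
      ENNReal.ofReal (∏ i, gaussianPDFReal (μ i) (v i) (y i)) := by
    refine (Finset.measurable_prod _ fun i _ => ?_).ennreal_ofReal
    exact (measurable_gaussianPDFReal _ _).comp (measurable_pi_apply i)
  have h := (PiLp.volume_preserving_ofLp (Fin d)).lintegral_comp hm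
  refine h.trans ?_
  rw [volume_pi, ← ofReal_integral_eq_lintegral_ofReal
    (Integrable.fintype_prod fun i => integrable_gaussianPDFReal (μ i) (v i))
    (ae_of_all _ fun y => Finset.prod_nonneg fun i _ => gaussianPDFReal_nonneg _ _ _),
    integral_fintype_prod_eq_prod (fun i => gaussianPDFReal (μ i) (v i))]
  simp [integral_gaussianPDFReal_eq_one _ (hv _)]

lemma propDensity_eq_prod (U : E d → ℝ) (σ : ℝ) (V : Stiefel d m) (x y : E d) :
    propDensity U σ V x y =
      ∏ i, gaussianPDFReal (x i - σ ^ 2 / 2 * gradEst U V x i) (Real.toNNReal (σ ^ 2)) (y i) := by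
  simp only [gaussianPDFReal, Finset.prod_mul_distrib, ← Real.exp_sum, propDensity,
    Real.coe_toNNReal _ (sq_nonneg σ), Finset.prod_const, Finset.card_univ, Fintype.card_fin,
    EuclideanSpace.norm_sq_eq, inv_pow, ← Finset.sum_div, Finset.sum_neg_distrib]
  simp [sq_abs]

lemma propDensity_pos (U : E d → ℝ) {σ : ℝ} (hσ : 0 < σ) (V : Stiefel d m) (x y : E d) :
    0 < propDensity U σ V x y := by
  unfold propDensity
  have := Real.pi_pos
  positivity

lemma lintegral_propDensity (U : E d → ℝ) {σ : ℝ} (hσ : 0 < σ) (V : Stiefel d m) (x : E d) :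
    ∫⁻ y, ENNReal.ofReal (propDensity U σ V x y) = 1 := by
  simp only [propDensity_eq_prod]
  exact lintegral_prod_gaussianPDFReal _ _ fun _ => by simpa using hσ.ne'

/-- The tilt uses half of the critical exponent `1 / (2σ²)`, so it doubles the variance and costs a
mass `√2`. -/
lemma gaussianPDFReal_mul_exp_sq {σ : ℝ} (hσ : 0 < σ) (μ y : ℝ) :
    gaussianPDFReal μ (Real.toNNReal (σ ^ 2)) y * Real.exp ((y - μ) ^ 2 / (4 * σ ^ 2)) =
      √2 * gaussianPDFReal μ (Real.toNNReal (2 * σ ^ 2)) y := by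
  have hπ := Real.pi_pos
  simp only [gaussianPDFReal, Real.coe_toNNReal _ (sq_nonneg σ),
    Real.coe_toNNReal _ (by positivity : 0 ≤ 2 * σ ^ 2)]
  have h1 : √(2 * Real.pi * (2 * σ ^ 2)) = √2 * √(2 * Real.pi * σ ^ 2) := by
    rw [← Real.sqrt_mul (by norm_num)]; ring_nf
  have h2 : 0 < √(2 * Real.pi * σ ^ 2) := by positivity
  have h3 : (0 : ℝ) < √2 := by positivity
  rw [h1, mul_assoc, ← Real.exp_add, ← mul_assoc]
  congr 1
  · field_simp
  · congr 1; field_simp; ring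

/-- Completing the square in a one-dimensional Gaussian integral tilted by
`exp (-t * ((y - a) ^ 2 - (x - a) ^ 2))`. -/
lemma gaussianPDFReal_mul_exp_tilt {σ t w : ℝ} (hσ : 0 < σ) (ht : 0 ≤ t)
    (hw : w = 2 * t * σ ^ 2 / (1 + 2 * t * σ ^ 2)) (a x y : ℝ) :
    gaussianPDFReal x (Real.toNNReal (σ ^ 2)) y *
        Real.exp (-(t * ((y - a) ^ 2 - (x - a) ^ 2))) =
      (√(1 - w) * Real.exp (t * w * (x - a) ^ 2)) *
        gaussianPDFReal (x - w * (x - a)) (Real.toNNReal (σ ^ 2 * (1 - w))) y := by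
  have hπ := Real.pi_pos
  have hs : 0 < 1 + 2 * t * σ ^ 2 := by positivity
  have hw1 : 1 - w = (1 + 2 * t * σ ^ 2)⁻¹ := by rw [hw]; field_simp; ring
  have hw0 : 0 < 1 - w := by rw [hw1]; positivity
  simp only [gaussianPDFReal, Real.coe_toNNReal _ (sq_nonneg σ),
    Real.coe_toNNReal _ (by positivity : 0 ≤ σ ^ 2 * (1 - w))]
  have h1 : √(2 * Real.pi * (σ ^ 2 * (1 - w))) = √(1 - w) * √(2 * Real.pi * σ ^ 2) := by
    rw [← Real.sqrt_mul hw0.le]; ring_nf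
  have h2 : 0 < √(2 * Real.pi * σ ^ 2) := by positivity
  have h3 : 0 < √(1 - w) := by positivity
  rw [h1, mul_assoc, ← Real.exp_add]
  have : ∀ A B C F : ℝ, A * F * (B * C) = (A * B) * (F * C) := by intros; ring
  rw [this, ← Real.exp_add]
  congr 1
  · field_simp
  · congr 1
    rw [hw1, hw]; field_simp; ring

lemma sqrt_one_sub_le_exp (w : ℝ) : √(1 - w) ≤ Real.exp (-w / 2) := by
  rw [Real.exp_half]
  exact Real.sqrt_le_sqrt (by linarith [Real.add_one_le_exp (-w)])

lemma isProbabilityMeasure_proposal (U : E d → ℝ) {σ : ℝ} (hσ : 0 < σ) (V : Stiefel d m)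
    (x : E d) : IsProbabilityMeasure (proposal U σ V x) :=
  ⟨by rw [proposal, withDensity_apply _ .univ, setLIntegral_univ, lintegral_propDensity U hσ]⟩

lemma measurable_propDensity_right (U : E d → ℝ) (σ : ℝ) (V : Stiefel d m) (x : E d) :
    Measurable (propDensity U σ V x) := by
  unfold propDensity
  fun_prop

/-- A bound on a Laplace transform controls the mean. -/
lemma lintegral_le_of_lintegral_exp_le {α : Type*} [MeasurableSpace α] (ρ : Measure α)
    [IsProbabilityMeasure ρ] {g : α → ℝ} (hg : Measurable g) {c : ℝ} (hc : 0 ≤ c)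
    (h : ∫⁻ x, ENNReal.ofReal (Real.exp (g x)) ∂ρ ≤ ENNReal.ofReal (Real.exp c)) :
    ∫⁻ x, ENNReal.ofReal (g x) ∂ρ ≤ ENNReal.ofReal (c + 1) := by
  calc ∫⁻ x, ENNReal.ofReal (g x) ∂ρ
      ≤ ∫⁻ x, (ENNReal.ofReal c +
          ENNReal.ofReal (Real.exp (-c)) * ENNReal.ofReal (Real.exp (g x))) ∂ρ := by
        refine lintegral_mono fun x => ?_
        rw [← ENNReal.ofReal_mul (Real.exp_pos _).le, ← Real.exp_add,
          ← ENNReal.ofReal_add hc (Real.exp_pos _).le]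
        -- This is `z + 1 ≤ exp z` at `z = g x - c`.
        exact ENNReal.ofReal_le_ofReal (by linarith [Real.add_one_le_exp (-c + g x)])
    _ = ENNReal.ofReal c +
          ENNReal.ofReal (Real.exp (-c)) * ∫⁻ x, ENNReal.ofReal (Real.exp (g x)) ∂ρ := by
        rw [lintegral_add_left measurable_const, lintegral_const_mul _ (by fun_prop)]
        simp
    _ ≤ ENNReal.ofReal c + ENNReal.ofReal (Real.exp (-c)) * ENNReal.ofReal (Real.exp c) := by
        gcongr
    _ = ENNReal.ofReal (c + 1) := by
        rw [← ENNReal.ofReal_mul (Real.exp_pos _).le, ← Real.exp_add, neg_add_cancel, Real.exp_zero,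
          ← ENNReal.ofReal_add hc zero_le_one]

/-- The second moment of the proposal around its mean is of order `d σ²`. -/
lemma lintegral_sq_norm_sub_mean_le (U : E d → ℝ) {σ : ℝ} (hσ : 0 < σ) (V : Stiefel d m)
    (x : E d) :
    ∫⁻ y, ENNReal.ofReal (‖y - (x - (σ ^ 2 / 2) • gradEst U V x)‖ ^ 2) ∂proposal U σ V x ≤
      ENNReal.ofReal (4 * σ ^ 2 * (d / 2 + 1)) := by
  have := isProbabilityMeasure_proposal U hσ V x
  set μ := x - (σ ^ 2 / 2) • gradEst U V x with hμ
  have hexp : ∫⁻ y, ENNReal.ofReal (Real.exp (‖y - μ‖ ^ 2 / (4 * σ ^ 2))) ∂proposal U σ V x ≤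
      ENNReal.ofReal (Real.exp (d / 2)) := by
    have key : ∀ y : E d, propDensity U σ V x y * Real.exp (‖y - μ‖ ^ 2 / (4 * σ ^ 2)) =
        √2 ^ d * ∏ i, gaussianPDFReal (μ i) (Real.toNNReal (2 * σ ^ 2)) (y i) := by
      intro y
      have : Real.exp (‖y - μ‖ ^ 2 / (4 * σ ^ 2)) =
          ∏ i, Real.exp ((y i - μ i) ^ 2 / (4 * σ ^ 2)) := by
        rw [← Real.exp_sum, EuclideanSpace.norm_sq_eq, Finset.sum_div]
        simp [sq_abs]
      rw [this, propDensity_eq_prod, ← Finset.prod_mul_distrib]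
      have h2 : √2 ^ d = ∏ _i : Fin d, √2 := by simp
      rw [h2, ← Finset.prod_mul_distrib]
      refine Finset.prod_congr rfl fun i _ => ?_
      have : μ i = x i - σ ^ 2 / 2 * gradEst U V x i := by simp [hμ]
      rw [← this, gaussianPDFReal_mul_exp_sq hσ]
    rw [proposal, lintegral_withDensity_eq_lintegral_mul _
      (measurable_propDensity_right U σ V x).ennreal_ofReal (by fun_prop)]
    simp only [Pi.mul_apply, ← ENNReal.ofReal_mul (propDensity_pos U hσ V x _).le, key,
      ENNReal.ofReal_mul (by positivity : 0 ≤ √2 ^ d)]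
    rw [lintegral_const_mul' _ _ ENNReal.ofReal_ne_top,
      lintegral_prod_gaussianPDFReal _ _ fun _ => by simpa using pow_pos hσ 2, mul_one]
    refine ENNReal.ofReal_le_ofReal ?_
    have h1 : √2 ≤ Real.exp (1 / 2) := by
      rw [Real.exp_half]
      exact Real.sqrt_le_sqrt (by linarith [Real.add_one_le_exp (1 : ℝ)])
    calc √2 ^ d ≤ Real.exp (1 / 2) ^ d := by gcongr
      _ = Real.exp (d / 2) := by rw [← Real.exp_nat_mul]; ring_nf
  have h := lintegral_le_of_lintegral_exp_le _ (by fun_prop) (by positivity) hexp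
  calc ∫⁻ y, ENNReal.ofReal (‖y - μ‖ ^ 2) ∂proposal U σ V x
      = ENNReal.ofReal (4 * σ ^ 2) *
          ∫⁻ y, ENNReal.ofReal (‖y - μ‖ ^ 2 / (4 * σ ^ 2)) ∂proposal U σ V x := by
        rw [← lintegral_const_mul' _ _ ENNReal.ofReal_ne_top]
        refine lintegral_congr fun y => ?_
        rw [← ENNReal.ofReal_mul (by positivity)]
        congr 1; field_simp
    _ ≤ _ := by
        rw [ENNReal.ofReal_mul (p := 4 * σ ^ 2) (by positivity)]
        exact mul_le_mul' le_rfl h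

/-! ### Coordinates that the directions leave free, and the drift along them. -/

open Classical in
/-- The coordinates on which all the directions vanish. -/
def freeCoords (V : Stiefel d m) : Finset (Fin d) := {i | ∀ k, V.1 i k = 0}

lemma mem_freeCoords {V : Stiefel d m} {i : Fin d} : i ∈ freeCoords V ↔ ∀ k, V.1 i k = 0 := by
  simp [freeCoords]

/-- Each of the `m` columns is supported on a single row, so at most `m` rows are nonzero. -/
lemma le_card_freeCoords {V : Stiefel d m}
    (hV : ∀ j : Fin m, ∃ i : Fin d, V.1.col j = Pi.single i 1) :
    d ≤ m + (freeCoords V).card := by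
  classical
  choose c hc using hV
  have hsub : (freeCoords V)ᶜ ⊆ Finset.univ.image c := by
    intro i hi
    rw [Finset.mem_compl, mem_freeCoords] at hi
    push Not at hi
    obtain ⟨k, hk⟩ := hi
    have h := congrFun (hc k) i
    simp only [Matrix.col_apply] at h
    rw [h] at hk
    refine Finset.mem_image.2 ⟨k, Finset.mem_univ _, ?_⟩
    by_contra hne
    exact hk (Pi.single_eq_of_ne (Ne.symm hne) _)
  have h1 := (Finset.card_le_card hsub).trans Finset.card_image_le
  rw [Finset.card_compl] at h1
  simp at h1
  omega

lemma gradEst_apply_of_mem_freeCoords (U : E d → ℝ) {V : Stiefel d m} (x : E d) {i : Fin d}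
    (hi : i ∈ freeCoords V) : gradEst U V x i = 0 := by
  rw [mem_freeCoords] at hi
  simp [gradEst, Matrix.mulVec, dotProduct, Matrix.mul_apply, hi]

/-- The change of the squared distance to `a` along the free coordinates. -/
def freeDrift (V : Stiefel d m) (a x y : E d) : ℝ :=
  ∑ i ∈ freeCoords V, ((y i - a i) ^ 2 - (x i - a i) ^ 2)

/-- Laplace transform of the drift: the proposal moves away from `a` along the free coordinates. -/
lemma lintegral_exp_freeDrift_le (U : E d → ℝ) {σ t w : ℝ} (hσ : 0 < σ) (ht : 0 ≤ t)
    (hw : w = 2 * t * σ ^ 2 / (1 + 2 * t * σ ^ 2)) (V : Stiefel d m) (a x : E d) :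
    ∫⁻ y, ENNReal.ofReal (propDensity U σ V x y * Real.exp (-(t * freeDrift V a x y))) ≤
      ENNReal.ofReal (Real.exp (-((freeCoords V).card * w / 2) + t * w * ‖x - a‖ ^ 2)) := by
  classical
  have hs : 0 < 1 + 2 * t * σ ^ 2 := by positivity
  have hw0 : 0 ≤ w := by rw [hw]; positivity
  have hw1 : 0 < 1 - w := by
    have : 1 - w = (1 + 2 * t * σ ^ 2)⁻¹ := by rw [hw]; field_simp; ring
    rw [this]; positivity
  -- The integrand factorises: a free coordinate becomes a tilted Gaussian of mass `c i`, any other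
  -- keeps its proposal density.
  let c : Fin d → ℝ := fun i =>
    if i ∈ freeCoords V then √(1 - w) * Real.exp (t * w * (x i - a i) ^ 2) else 1
  let μ : Fin d → ℝ := fun i => if i ∈ freeCoords V then x i - w * (x i - a i)
    else x i - σ ^ 2 / 2 * gradEst U V x i
  let v : Fin d → ℝ≥0 := fun i => if i ∈ freeCoords V then Real.toNNReal (σ ^ 2 * (1 - w))
    else Real.toNNReal (σ ^ 2)
  have hc : ∀ i, 0 ≤ c i := fun i => by dsimp only [c]; split_ifs <;> positivity
  have hv : ∀ i, v i ≠ 0 := fun i => by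
    have : 0 < σ ^ 2 * (1 - w) := by positivity
    dsimp only [v]
    split_ifs
    · simpa using this
    · simpa using hσ.ne'
  have key : ∀ y : E d, propDensity U σ V x y * Real.exp (-(t * freeDrift V a x y)) =
      (∏ i, c i) * ∏ i, gaussianPDFReal (μ i) (v i) (y i) := by
    intro y
    have he : Real.exp (-(t * freeDrift V a x y)) = ∏ i, if i ∈ freeCoords V then
        Real.exp (-(t * ((y i - a i) ^ 2 - (x i - a i) ^ 2))) else 1 := by
      rw [Finset.prod_ite_mem, Finset.univ_inter, ← Real.exp_sum, freeDrift, Finset.mul_sum,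
        Finset.sum_neg_distrib]
    rw [he, propDensity_eq_prod, ← Finset.prod_mul_distrib, ← Finset.prod_mul_distrib]
    refine Finset.prod_congr rfl fun i _ => ?_
    dsimp only [c, μ, v]
    split_ifs with hi
    · rw [gradEst_apply_of_mem_freeCoords U x hi, mul_zero, sub_zero,
        gaussianPDFReal_mul_exp_tilt hσ ht hw]
    · ring
  simp only [key, ENNReal.ofReal_mul (Finset.prod_nonneg fun i _ => hc i)]
  rw [lintegral_const_mul' _ _ ENNReal.ofReal_ne_top, lintegral_prod_gaussianPDFReal _ _ hv, mul_one]
  refine ENNReal.ofReal_le_ofReal ?_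
  -- The factors `exp (t w (x i - a i)²) ≥ 1` are inserted at the other coordinates too, so that the
  -- full norm `‖x - a‖²` appears.
  calc ∏ i, c i ≤ ∏ i, (if i ∈ freeCoords V then Real.exp (-w / 2) else 1) *
        Real.exp (t * w * (x i - a i) ^ 2) := by
        refine Finset.prod_le_prod (fun i _ => hc i) fun i _ => ?_
        dsimp only [c]
        split_ifs
        · gcongr
          exact sqrt_one_sub_le_exp w
        · rw [one_mul]
          exact Real.one_le_exp (by positivity)
    _ = _ := by
        rw [Finset.prod_mul_distrib, Finset.prod_ite_mem, Finset.univ_inter, Finset.prod_const,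
          ← Real.exp_sum, ← Real.exp_nat_mul, ← Real.exp_add, ← Finset.mul_sum,
          EuclideanSpace.norm_sq_eq]
        simp only [PiLp.sub_apply, Real.norm_eq_abs, sq_abs]
        ring_nf

/-! ### The target: minimiser, concentration around it, second differences of `U`. -/

namespace IsTarget

variable {L : ℝ≥0} {lam : ℝ} {U : E d → ℝ} {π : Measure (E d)}

/-- Convexity of `U - lam/2 ‖·‖²` between `0`, `x / ‖x‖` and `x` gives `U x - U 0 ≥ lam/2 ‖x‖² - M
‖x‖` with `M` a bound on the unit ball, so `U` is at least `U 0` far away. -/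
lemma exists_isMin (h : IsTarget L lam U π) (hlam : 0 < lam) : ∃ a, ∀ x, U a ≤ U x := by
  have hcont : Continuous U := h.contDiff.continuous
  refine hcont.exists_forall_le' 0 ?_
  obtain ⟨M, hM⟩ := (isCompact_closedBall (0 : E d) 1).exists_bound_of_continuousOn
    (f := fun x => (U x - lam / 2 * ‖x‖ ^ 2) - U 0) (by fun_prop)
  filter_upwards [(tendsto_norm_cocompact_atTop (E := E d)).eventually_ge_atTop
    (max 1 (2 * M / lam))] with x hx
  have hx1 : 1 ≤ ‖x‖ := (le_max_left _ _).trans hx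
  have hx2 : 2 * M / lam ≤ ‖x‖ := (le_max_right _ _).trans hx
  have hxpos : 0 < ‖x‖ := by linarith
  have hu : ‖‖x‖⁻¹ • x‖ = 1 := by
    rw [norm_smul, norm_inv, norm_norm, inv_mul_cancel₀ hxpos.ne']
  have hb := hM (‖x‖⁻¹ • x) (by simp [hu])
  have hc := h.convex.2 (Set.mem_univ (0 : E d)) (Set.mem_univ x)
    (sub_nonneg.2 (inv_le_one_of_one_le₀ hx1)) (inv_nonneg.2 hxpos.le) (by ring)
  simp only [smul_zero, zero_add, norm_zero, smul_eq_mul] at hc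
  rw [Real.norm_eq_abs, abs_le] at hb
  rw [div_le_iff₀ hlam] at hx2
  set w := U (‖x‖⁻¹ • x) - lam / 2 * ‖‖x‖⁻¹ • x‖ ^ 2
  have h1 : ‖x‖ * (w - U 0) ≤ U x - lam / 2 * ‖x‖ ^ 2 - U 0 := by
    have := mul_le_mul_of_nonneg_left hc hxpos.le
    have e : ‖x‖ * ((1 - ‖x‖⁻¹) * (U 0 - lam / 2 * 0 ^ 2) +
        ‖x‖⁻¹ * (U x - lam / 2 * ‖x‖ ^ 2)) =
        ‖x‖ * U 0 - U 0 + (U x - lam / 2 * ‖x‖ ^ 2) := by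
      field_simp; ring
    rw [e] at this
    linarith
  nlinarith [hb.1]

lemma gradient_eq_zero {a : E d} (ha : ∀ x, U a ≤ U x) : gradient U a = 0 := by
  have : IsLocalMin U a := Filter.Eventually.of_forall ha
  simp [gradient, this.fderiv_eq_zero]

lemma norm_gradient_le (h : IsTarget L lam U π) {a : E d} (ha : ∀ x, U a ≤ U x) (x : E d) :
    ‖gradient U x‖ ≤ L * ‖x - a‖ := by
  simpa [gradient_eq_zero ha, dist_eq_norm] using h.smooth.dist_le_mul x a

/-- After removal of its quadratic part around the minimiser, `U` is monotone along rays. -/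
lemma add_sq_le (h : IsTarget L lam U π) {a : E d} (ha : ∀ x, U a ≤ U x) {θ : ℝ} (hθ : 1 ≤ θ)
    (u : E d) :
    U (a + u) + lam / 2 * (θ ^ 2 - 1) * ‖u‖ ^ 2 ≤ U (a + θ • u) := by
  -- Recentring the quadratic at `a` changes the function by an affine one only, so convexity
  -- persists.
  have hconv : ∀ (z : E d) (s : ℝ), 0 ≤ s → s ≤ 1 →
      U (a + s • z) - lam / 2 * s ^ 2 * ‖z‖ ^ 2 ≤
        (1 - s) * U a + s * (U (a + z) - lam / 2 * ‖z‖ ^ 2) := by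
    intro z s hs0 hs1
    have hc := h.convex.2 (Set.mem_univ a) (Set.mem_univ (a + z)) (sub_nonneg.2 hs1) hs0 (by ring)
    have e : (1 - s) • a + s • (a + z) = a + s • z := by module
    simp only [e, smul_eq_mul] at hc
    have n1 : ‖a + s • z‖ ^ 2 = ‖a‖ ^ 2 + 2 * s * inner ℝ a z + s ^ 2 * ‖z‖ ^ 2 := by
      rw [norm_add_sq_real, inner_smul_right, norm_smul, mul_pow, Real.norm_eq_abs, sq_abs]; ring
    have n2 : ‖a + z‖ ^ 2 = ‖a‖ ^ 2 + 2 * inner ℝ a z + ‖z‖ ^ 2 := norm_add_sq_real a z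
    rw [n1, n2] at hc
    linarith
  -- The recentred convex function is still minimal at `a`: a deficit `δ` at `z` would make `U` drop
  -- by `s δ` near `a`, while the quadratic term restores only order `s²`.
  have hmin : ∀ z : E d, U a ≤ U (a + z) - lam / 2 * ‖z‖ ^ 2 := by
    intro z
    by_contra hlt
    push Not at hlt
    set δ := U a - (U (a + z) - lam / 2 * ‖z‖ ^ 2) with hδ
    have hδ0 : 0 < δ := by linarith
    have hle : ∀ s : ℝ, 0 < s → s ≤ 1 → δ ≤ s * (|lam / 2| * ‖z‖ ^ 2) := by
      intro s hs0 hs1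
      have h1 := hconv z s hs0.le hs1
      have h2 := ha (a + s • z)
      have h3 : s * δ ≤ s * (s * (lam / 2 * ‖z‖ ^ 2)) := by rw [hδ]; nlinarith
      have h4 := le_of_mul_le_mul_left h3 hs0
      refine h4.trans ?_
      gcongr
      exact le_abs_self _
    set B := |lam / 2| * ‖z‖ ^ 2 with hB
    have hB0 : 0 ≤ B := by positivity
    have := hle (min 1 (δ / (2 * (B + 1)))) (by positivity) (min_le_left _ _)
    have h5 : min 1 (δ / (2 * (B + 1))) * B ≤ δ / (2 * (B + 1)) * (B + 1) := by
      have := min_le_right (1 : ℝ) (δ / (2 * (B + 1)))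
      have h0 : 0 ≤ δ / (2 * (B + 1)) := by positivity
      nlinarith
    have h6 : δ / (2 * (B + 1)) * (B + 1) = δ / 2 := by field_simp
    linarith
  have hθ0 : 0 < θ := by linarith
  have h1 := hconv (θ • u) θ⁻¹ (by positivity) (inv_le_one_of_one_le₀ hθ)
  have h2 := hmin (θ • u)
  rw [smul_smul, inv_mul_cancel₀ hθ0.ne', one_smul] at h1
  have n : ‖θ • u‖ ^ 2 = θ ^ 2 * ‖u‖ ^ 2 := by
    rw [norm_smul, mul_pow, Real.norm_eq_abs, sq_abs]
  rw [n] at h1 h2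
  have e : lam / 2 * θ⁻¹ ^ 2 * (θ ^ 2 * ‖u‖ ^ 2) = lam / 2 * ‖u‖ ^ 2 := by field_simp
  rw [e] at h1
  have h3 : (1 - θ⁻¹) * U a ≤ (1 - θ⁻¹) * (U (a + θ • u) - lam / 2 * (θ ^ 2 * ‖u‖ ^ 2)) :=
    mul_le_mul_of_nonneg_left h2 (sub_nonneg.2 (inv_le_one_of_one_le₀ hθ))
  linarith

lemma lintegral_eq (h : IsTarget L lam U π) {F : E d → ℝ≥0∞} (hF : Measurable F) :
    ∫⁻ x, F x ∂π = ∫⁻ x, ENNReal.ofReal (Real.exp (-U x)) * F x := by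
  have hU := h.contDiff.continuous.measurable
  rw [h.density, lintegral_withDensity_eq_lintegral_mul _ (by fun_prop) hF]
  rfl

lemma lintegral_exp_neg [IsProbabilityMeasure π] (h : IsTarget L lam U π) :
    ∫⁻ x, ENNReal.ofReal (Real.exp (-U x)) = 1 := by
  simpa using (h.lintegral_eq (F := fun _ => 1) measurable_const).symm

/-- Gaussian concentration of `π` around the minimiser of `U`. -/
lemma lintegral_exp_sq_norm_le [IsProbabilityMeasure π] (h : IsTarget L lam U π)
    (hlam : 0 < lam) {a : E d} (ha : ∀ x, U a ≤ U x) {α : ℝ} (hα : 0 ≤ α) (hα' : α ≤ lam / 4) :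
    ∫⁻ x, ENNReal.ofReal (Real.exp (α * ‖x - a‖ ^ 2)) ∂π ≤
      ENNReal.ofReal (Real.exp (2 * α * d / lam)) := by
  have hU := h.contDiff.continuous.measurable
  set r := 2 * α / lam with hr
  have hr0 : 0 ≤ r := by positivity
  have hr1 : r ≤ 1 / 2 := by rw [hr, div_le_iff₀ hlam]; linarith
  have hr2 : 0 < 1 - r := by linarith
  -- This dilation satisfies `α θ² = lam/2 (θ² - 1)`: after `x = a + θ u` the growth of `U` along
  -- the ray absorbs the exponential weight, leaving only the Jacobian `θ ^ d ≤ exp (r d)`.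
  set θ := √((1 - r)⁻¹) with hθ
  have hθsq : θ ^ 2 = (1 - r)⁻¹ := Real.sq_sqrt (by positivity)
  have hθ1 : 1 ≤ θ := by
    rw [hθ, Real.one_le_sqrt]
    exact (one_le_inv₀ hr2).2 (by linarith)
  have hθ0 : 0 < θ := by linarith
  have hθexp : θ ≤ Real.exp r := by
    have : Real.exp r = √(Real.exp (2 * r)) := by rw [← Real.exp_half]; ring_nf
    rw [this]
    refine Real.sqrt_le_sqrt ?_
    refine le_trans ?_ (Real.add_one_le_exp (2 * r))
    rw [inv_le_iff_one_le_mul₀ hr2]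
    nlinarith
  rw [h.lintegral_eq (by fun_prop)]
  simp only [← ENNReal.ofReal_mul (Real.exp_pos _).le, ← Real.exp_add]
  have hscale : ∀ F : E d → ℝ≥0∞, Measurable F →
      ∫⁻ x, F x = ENNReal.ofReal (θ ^ d) * ∫⁻ u, F (a + θ • u) := by
    intro F hF
    have h1 := lintegral_map (μ := (volume : Measure (E d))) (f := fun x => F (a + x))
      (g := fun u : E d => θ • u) (by fun_prop) (by fun_prop)
    rw [Measure.map_addHaar_smul _ hθ0.ne', lintegral_smul_measure,
      lintegral_add_left_eq_self] at h1
    rw [← h1, finrank_euclideanSpace_fin, abs_of_pos (by positivity), smul_eq_mul, ← mul_assoc,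
      ← ENNReal.ofReal_mul (by positivity), mul_inv_cancel₀ (by positivity), ENNReal.ofReal_one,
      one_mul]
  rw [hscale _ (by fun_prop)]
  calc ENNReal.ofReal (θ ^ d) * ∫⁻ u, ENNReal.ofReal
        (Real.exp (-U (a + θ • u) + α * ‖a + θ • u - a‖ ^ 2))
      ≤ ENNReal.ofReal (Real.exp r ^ d) * ∫⁻ u, ENNReal.ofReal (Real.exp (-U (a + u))) := by
        gcongr with u
        have h1 := h.add_sq_le ha hθ1 u
        have n : ‖a + θ • u - a‖ ^ 2 = θ ^ 2 * ‖u‖ ^ 2 := by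
          rw [add_sub_cancel_left, norm_smul, mul_pow, Real.norm_eq_abs, sq_abs]
        have e : lam / 2 * (θ ^ 2 - 1) = α * θ ^ 2 := by
          rw [hθsq]
          have hα2 : α = r * lam / 2 := by rw [hr]; field_simp
          rw [hα2]
          field_simp
          ring
        rw [n]
        rw [e] at h1
        linarith
    _ = _ := by
        rw [lintegral_add_left_eq_self (fun x => ENNReal.ofReal (Real.exp (-U x))),
          h.lintegral_exp_neg, mul_one, ← Real.exp_nat_mul, hr]
        congr 2; ring

lemma lintegral_sq_norm_le [IsProbabilityMeasure π] (h : IsTarget L lam U π)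
    (hlam : 0 < lam) {a : E d} (ha : ∀ x, U a ≤ U x) :
    ∫⁻ x, ENNReal.ofReal (‖x - a‖ ^ 2) ∂π ≤ ENNReal.ofReal (4 / lam * (d / 2 + 1)) := by
  have h0 := h.lintegral_exp_sq_norm_le hlam ha (α := lam / 4) (by positivity) le_rfl
  have e : 2 * (lam / 4) * d / lam = (d : ℝ) / 2 := by field_simp; ring
  rw [e] at h0
  have h1 := lintegral_le_of_lintegral_exp_le π (by fun_prop) (by positivity) h0
  calc ∫⁻ x, ENNReal.ofReal (‖x - a‖ ^ 2) ∂π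
      = ENNReal.ofReal (4 / lam) * ∫⁻ x, ENNReal.ofReal (lam / 4 * ‖x - a‖ ^ 2) ∂π := by
        rw [← lintegral_const_mul' _ _ ENNReal.ofReal_ne_top]
        refine lintegral_congr fun y => ?_
        rw [← ENNReal.ofReal_mul (by positivity)]
        congr 1; field_simp
    _ ≤ _ := by
        rw [ENNReal.ofReal_mul (p := 4 / lam) (by positivity)]
        exact mul_le_mul' le_rfl h1

lemma memLp_coord [IsProbabilityMeasure π] (h : IsTarget L lam U π) (hlam : 0 < lam)
    (i : Fin d) : MemLp (fun x : E d => x i) 2 π := by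
  obtain ⟨a, ha⟩ := h.exists_isMin hlam
  have hm : Measurable fun x : E d => x i - a i := by fun_prop
  have h1 : MemLp (fun x : E d => x i - a i) 2 π := by
    rw [memLp_two_iff_integrable_sq hm.aestronglyMeasurable]
    refine ⟨by fun_prop, ?_⟩
    rw [hasFiniteIntegral_iff_ofReal (ae_of_all _ fun x => sq_nonneg _)]
    refine lt_of_le_of_lt (lintegral_mono fun x => ENNReal.ofReal_le_ofReal ?_)
      ((h.lintegral_sq_norm_le hlam ha).trans_lt ENNReal.ofReal_lt_top)
    have := PiLp.norm_apply_le (x - a) i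
    rw [← sq_abs, ← Real.norm_eq_abs]
    exact pow_le_pow_left₀ (norm_nonneg _) (by simpa using this) 2
  convert h1.add (memLp_const (a i)) using 1
  ext x
  simp

/-- Smoothness of `U` bounds its second difference. -/
lemma add_sub_le (h : IsTarget L lam U π) (x v : E d) :
    U (x + v) + U (x - v) ≤ 2 * U x + 2 * L * ‖v‖ ^ 2 := by
  have hd : Differentiable ℝ U := h.contDiff.differentiable (by norm_num)
  let φ : ℝ → ℝ := fun s => U (x + s • v) + U (x - s • v)
  have hφ : ∀ s, HasDerivAt φ (inner ℝ (gradient U (x + s • v)) v -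
      inner ℝ (gradient U (x - s • v)) v) s := by
    intro s
    have l1 : HasDerivAt (fun s : ℝ => x + s • v) v s := by
      simpa using ((hasDerivAt_id s).smul_const v).const_add x
    have l2 : HasDerivAt (fun s : ℝ => x - s • v) (-v) s := by
      simpa using ((hasDerivAt_id s).smul_const v).const_sub x
    have g1 := ((hd (x + s • v)).hasGradientAt.hasFDerivAt).comp_hasDerivAt s l1
    have g2 := ((hd (x - s • v)).hasGradientAt.hasFDerivAt).comp_hasDerivAt s l2
    have hsum : HasDerivAt φ _ s := g1.add g2
    refine hsum.congr_deriv ?_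
    simp [sub_eq_add_neg]
  obtain ⟨s, hs, hs'⟩ := exists_hasDerivAt_eq_slope φ _ zero_lt_one
    (fun s _ => (hφ s).continuousAt.continuousWithinAt) (fun s _ => hφ s)
  have hb : inner ℝ (gradient U (x + s • v)) v - inner ℝ (gradient U (x - s • v)) v ≤
      2 * L * ‖v‖ ^ 2 := by
    rw [← inner_sub_left]
    refine (real_inner_le_norm _ _).trans ?_
    have h1 := h.smooth.dist_le_mul (x + s • v) (x - s • v)
    rw [dist_eq_norm, dist_eq_norm] at h1
    have e : x + s • v - (x - s • v) = (2 * s) • v := by module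
    rw [e, norm_smul, Real.norm_eq_abs, abs_of_pos (by linarith [hs.1])] at h1
    have h2 : (L : ℝ) * (2 * s * ‖v‖) ≤ L * (2 * ‖v‖) := by
      gcongr; linarith [hs.2]
    calc _ ≤ (L * (2 * ‖v‖)) * ‖v‖ := by gcongr; exact h1.trans h2
      _ = _ := by ring
  have e0 : φ 0 = 2 * U x := by simp [φ]; ring
  have e1 : φ 1 = U (x + v) + U (x - v) := by simp [φ]
  rw [e0, e1] at hs'
  linarith [hs'.le, hs'.ge]

end IsTarget

/-! ### Test functions: coordinate variances and a ball of mass one half. -/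

namespace IsTarget

variable {L : ℝ≥0} {lam : ℝ} {U : E d → ℝ} {π : Measure (E d)}

/-- A smooth potential cannot concentrate in any coordinate. -/
lemma le_variance_coord [IsProbabilityMeasure π] (h : IsTarget L lam U π) (hlam : 0 < lam)
    (i : Fin d) :
    Real.exp (-L) / (1 + Real.exp (-L)) ≤ variance (fun x : E d => x i) π := by
  have hU := h.contDiff.continuous.measurable
  set f : E d → ℝ := fun x => x i - ∫ y, y i ∂π with hf
  set S := Real.exp (-(L : ℝ)) with hS
  have hS0 : 0 < S := Real.exp_pos _
  set v : E d := EuclideanSpace.single i 1 with hv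
  have hvn : ‖v‖ = 1 := by simp [hv]
  have hvi : v i = 1 := by simp [hv]
  set Vr := variance (fun x : E d => x i) π with hVr
  have hVr0 : 0 ≤ Vr := variance_nonneg _ _
  have hfm : Measurable f := by fun_prop
  have hI : ∫⁻ x, ENNReal.ofReal (Real.exp (-U x) * f x ^ 2) = ENNReal.ofReal Vr := by
    rw [hVr, (h.memLp_coord hlam i).ofReal_variance_eq, evariance_eq_lintegral_ofReal,
      h.lintegral_eq (by fun_prop)]
    simp only [← ENNReal.ofReal_mul (Real.exp_pos _).le]
    rfl
  have hI1 : ∫⁻ x, ENNReal.ofReal (Real.exp (-U (x + v)) * (f x + 1) ^ 2) = ENNReal.ofReal Vr := by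
    rw [← hI, ← lintegral_add_right_eq_self
      (fun x => ENNReal.ofReal (Real.exp (-U x) * f x ^ 2)) v]
    refine lintegral_congr fun x => ?_
    have : f (x + v) = f x + 1 := by simp [hf, hvi]; ring
    rw [this]
  have hI2 : ∫⁻ x, ENNReal.ofReal (Real.exp (-U (x - v)) * (f x - 1) ^ 2) = ENNReal.ofReal Vr := by
    rw [← hI, ← lintegral_sub_right_eq_self
      (fun x => ENNReal.ofReal (Real.exp (-U x) * f x ^ 2)) v]
    refine lintegral_congr fun x => ?_
    have : f (x - v) = f x - 1 := by simp [hf, hvi]; ring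
    rw [this]
  -- The translates by `± v` would see small variance only if `f + 1`, `f - 1` and `f` were all
  -- small. For `|f x| ≤ 1` use AM-GM on the first two terms and `A B ≥ S exp (-U x)`; otherwise the
  -- last term suffices.
  have hpt : ∀ x, 2 * S * Real.exp (-U x) ≤ Real.exp (-U (x + v)) * (f x + 1) ^ 2 +
      (Real.exp (-U (x - v)) * (f x - 1) ^ 2 + 2 * S * (Real.exp (-U x) * f x ^ 2)) := by
    intro x
    have hsq : ∀ z : ℝ, Real.exp (-z) = Real.exp (-z / 2) ^ 2 := fun z => by
      rw [← Real.exp_nat_mul]; congr 1; push_cast; ring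
    have hprod : S * Real.exp (-U x) ≤ Real.exp (-U (x + v) / 2) * Real.exp (-U (x - v) / 2) := by
      rw [hS, ← Real.exp_add, ← Real.exp_add, Real.exp_le_exp]
      have := h.add_sub_le x v
      rw [hvn] at this
      linarith
    rw [hsq (U (x + v)), hsq (U (x - v))]
    set A := Real.exp (-U (x + v) / 2) with hA
    set B := Real.exp (-U (x - v) / 2) with hB
    have hA0 : 0 < A := Real.exp_pos _
    have hB0 : 0 < B := Real.exp_pos _
    have hp0 : 0 < S * Real.exp (-U x) := mul_pos hS0 (Real.exp_pos _)
    rcases le_total (f x ^ 2) 1 with h1 | h1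
    · nlinarith [sq_nonneg (A * (f x + 1) + B * (f x - 1)),
        mul_le_mul_of_nonneg_right hprod (sub_nonneg.2 h1)]
    · nlinarith [sq_nonneg (A * (f x + 1)), sq_nonneg (B * (f x - 1)),
        mul_le_mul_of_nonneg_left h1 hp0.le]
  have hmain : ENNReal.ofReal (2 * S) ≤ ENNReal.ofReal (Vr + (Vr + 2 * S * Vr)) := by
    calc ENNReal.ofReal (2 * S)
        = ∫⁻ x, ENNReal.ofReal (2 * S * Real.exp (-U x)) := by
          simp only [ENNReal.ofReal_mul (by positivity : 0 ≤ 2 * S)]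
          rw [lintegral_const_mul' _ _ ENNReal.ofReal_ne_top, h.lintegral_exp_neg, mul_one]
      _ ≤ ∫⁻ x, (ENNReal.ofReal (Real.exp (-U (x + v)) * (f x + 1) ^ 2) +
          (ENNReal.ofReal (Real.exp (-U (x - v)) * (f x - 1) ^ 2) +
            ENNReal.ofReal (2 * S) * ENNReal.ofReal (Real.exp (-U x) * f x ^ 2))) := by
          refine lintegral_mono fun x => ?_
          rw [← ENNReal.ofReal_mul (by positivity), ← ENNReal.ofReal_add (by positivity)
            (by positivity), ← ENNReal.ofReal_add (by positivity) (by positivity)]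
          exact ENNReal.ofReal_le_ofReal (hpt x)
      _ = _ := by
          rw [lintegral_add_left (by fun_prop), lintegral_add_left (by fun_prop),
            lintegral_const_mul' _ _ ENNReal.ofReal_ne_top, hI, hI1, hI2,
            ← ENNReal.ofReal_mul (by positivity), ← ENNReal.ofReal_add (by positivity)
            (by positivity), ← ENNReal.ofReal_add (by positivity) (by positivity)]
  rw [ENNReal.ofReal_le_ofReal_iff (by positivity)] at hmain
  rw [div_le_iff₀ (by positivity)]
  linarith

/-- Some ball has mass one half. -/
lemma exists_measure_norm_le_eq_half [IsProbabilityMeasure π] [NeZero d]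
    (h : IsTarget L lam U π) : ∃ r : ℝ, π.real {x | ‖x‖ ≤ r} = 1 / 2 := by
  have hd : 0 < d := Nat.pos_of_ne_zero (NeZero.ne d)
  have : Nontrivial (E d) := by
    have : Nonempty (Fin d) := ⟨⟨0, hd⟩⟩
    infer_instance
  have hac : π ≪ volume := by rw [h.density]; exact withDensity_absolutelyContinuous _ _
  let ρ : Measure ℝ := π.map fun x => ‖x‖
  have : IsProbabilityMeasure ρ := Measure.isProbabilityMeasure_map (by fun_prop)
  have hatom : ∀ r, ρ {r} = 0 := by
    intro r
    rw [Measure.map_apply measurable_norm (measurableSet_singleton r)]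
    have : (fun x : E d => ‖x‖) ⁻¹' {r} = Metric.sphere 0 r := by ext; simp
    rw [this]
    exact hac (Measure.addHaar_sphere _ _ _)
  -- Spheres are Lebesgue-null, so the law of the norm has no atoms and the intermediate value
  -- theorem applies to its distribution function.
  have hcont : Continuous (cdf ρ) := by
    refine continuous_iff_continuousAt.2 fun r => ?_
    rw [(monotone_cdf ρ).continuousAt_iff_leftLim_eq_rightLim, (cdf ρ).rightLim_eq]
    have h1 := (cdf ρ).measure_singleton r
    rw [measure_cdf, hatom r, eq_comm, ENNReal.ofReal_eq_zero] at h1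
    exact le_antisymm ((monotone_cdf ρ).leftLim_le le_rfl) (by linarith)
  obtain ⟨r, hr⟩ := mem_range_of_exists_le_of_exists_ge hcont
    (((tendsto_cdf_atBot ρ).eventually_le_const (by norm_num : (0 : ℝ) < 1 / 2)).exists)
    (((tendsto_cdf_atTop ρ).eventually_const_le (by norm_num : (1 / 2 : ℝ) < 1)).exists)
  refine ⟨r, ?_⟩
  rw [cdf_eq_real, map_measureReal_apply measurable_norm measurableSet_Iic] at hr
  exact hr

end IsTarget

/-! ### The Dirichlet form of the kernel. -/

lemma measurable_propDensity_pair {U : E d → ℝ} (hU : ContDiff ℝ 2 U) (σ : ℝ) (V : Stiefel d m) :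
    Measurable fun p : E d × E d => propDensity U σ V p.1 p.2 :=
  (measurable_propDensity (m := m) hU σ).comp
    (f := fun p : E d × E d => ((p.1, V), p.2)) (by fun_prop)

lemma measurable_acceptProb_right {U : E d → ℝ} (hU : ContDiff ℝ 2 U) (σ : ℝ) (V : Stiefel d m)
    (x : E d) : Measurable (acceptProb U σ V x) :=
  (measurable_acceptProb (m := m) hU σ).comp
    (f := fun y : E d => ((x, V), y)) (by fun_prop)

lemma acceptProb_le_one (U : E d → ℝ) (σ : ℝ) (V : Stiefel d m) (x y : E d) :
    acceptProb U σ V x y ≤ 1 := min_le_left _ _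

/-- Only accepted moves contribute to integrals of functions vanishing at the current state. -/
lemma lintegral_smala {U : E d → ℝ} (hU : ContDiff ℝ 2 U) (ν : Measure (Stiefel d m)) [SFinite ν]
    (σ : ℝ) {x : E d} {F : E d → ℝ≥0∞} (hF : Measurable F) (hx : F x = 0) :
    ∫⁻ y, F y ∂smala hU ν σ x =
      ∫⁻ V, ∫⁻ y, ENNReal.ofReal (acceptProb U σ V x y) * F y ∂proposal U σ V x ∂ν := by
  change ∫⁻ y, F y ∂(ν.bind fun V => mhStep U σ V x) = _
  have hms : Measurable fun V : Stiefel d m => mhStep U σ V x :=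
    Measurable.comp (g := fun p : E d × Stiefel d m => mhStep U σ p.2 p.1)
      (f := fun V => (x, V)) (measurable_mhStep hU σ) (by fun_prop)
  rw [Measure.lintegral_bind hms.aemeasurable hF.aemeasurable]
  refine lintegral_congr fun V => ?_
  have h1 := lintegral_withDensity_eq_lintegral_mul (proposal U σ V x)
    (measurable_acceptProb_right hU σ V x).ennreal_ofReal hF
  rw [mhStep, lintegral_add_measure, lintegral_smul_measure, lintegral_dirac' _ hF, hx, smul_zero,
    add_zero]
  exact h1

/-! ### Large steps: the acceptance rate is exponentially small. -/

section

variable {L : ℝ≥0} {lam : ℝ} {U : E d → ℝ} {π : Measure (E d)}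

lemma rightGap_le {f : E d → ℝ} (P : Kernel (E d) (E d)) (hf : MemLp f 2 π)
    (hv : 0 < variance f π) :
    rightGap π P ≤ (∫⁻ x, ∫⁻ y, ENNReal.ofReal ((f x - f y) ^ 2) ∂P x ∂π) /
      ENNReal.ofReal (2 * variance f π) :=
  (iInf_le _ f).trans ((iInf_le _ hf).trans (iInf_le _ hv))

/-- The gap is at most a multiple of the average acceptance rate. -/
lemma rightGap_smala_le_accept [IsProbabilityMeasure π] [NeZero d] (h : IsTarget L lam U π)
    (ν : Measure (Stiefel d m)) [SFinite ν] (σ : ℝ) :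
    rightGap π (smala h.contDiff ν σ) ≤
      2 * ∫⁻ x, ∫⁻ V, ∫⁻ y, ENNReal.ofReal (acceptProb U σ V x y) ∂proposal U σ V x ∂ν ∂π := by
  classical
  obtain ⟨r, hr⟩ := h.exists_measure_norm_le_eq_half
  set A : Set (E d) := {x | ‖x‖ ≤ r} with hA
  have hAm : MeasurableSet A := measurableSet_le measurable_norm measurable_const
  set f : E d → ℝ := A.indicator 1 with hf
  have hfm : Measurable f := measurable_one.indicator hAm
  have hmem : MemLp f 2 π := memLp_indicator_const 2 hAm (1 : ℝ) (Or.inr (measure_ne_top _ _))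
  have hint : ∫ x, f x ∂π = 1 / 2 := by
    rw [hf, integral_indicator_one hAm, hr]
  have hsq : f ^ 2 = f := by
    ext x
    by_cases hx : x ∈ A <;> simp [hf, hx]
  have hvar : variance f π = 1 / 4 := by
    rw [variance_eq_sub hmem, hsq, hint]; norm_num
  refine (rightGap_le _ hmem (by rw [hvar]; norm_num)).trans ?_
  have e : ENNReal.ofReal (2 * variance f π) = 2⁻¹ := by
    rw [hvar, ← ENNReal.ofReal_ofNat 2, ← ENNReal.ofReal_inv_of_pos (by norm_num)]; norm_num
  rw [e, div_eq_mul_inv, inv_inv, mul_comm]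
  refine mul_le_mul' le_rfl (lintegral_mono fun x => ?_)
  rw [lintegral_smala h.contDiff ν σ (F := fun y => ENNReal.ofReal ((f x - f y) ^ 2))
    (by fun_prop) (by simp)]
  refine lintegral_mono fun V => lintegral_mono fun y => ?_
  refine mul_le_of_le_one_right' ?_
  rw [ENNReal.ofReal_le_one]
  by_cases hx : x ∈ A <;> by_cases hy : y ∈ A <;> simp [hf, hx, hy]

lemma freeDrift_swap (V : Stiefel d m) (a x y : E d) :
    freeDrift V a y x = -freeDrift V a x y := by
  simp [freeDrift]

lemma lintegral_proposal_acceptProb (hU : ContDiff ℝ 2 U) (σ : ℝ) (V : Stiefel d m) (x : E d) :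
    ∫⁻ y, ENNReal.ofReal (acceptProb U σ V x y) ∂proposal U σ V x =
      ∫⁻ y, ENNReal.ofReal (propDensity U σ V x y) * ENNReal.ofReal (acceptProb U σ V x y) :=
  lintegral_withDensity_eq_lintegral_mul _ (measurable_propDensity_right U σ V x).ennreal_ofReal
    (measurable_acceptProb_right hU σ V x).ennreal_ofReal

lemma measurable_lintegral_acceptProb (hU : ContDiff ℝ 2 U) (σ : ℝ) :
    Measurable fun p : E d × Stiefel d m =>
      ∫⁻ y, ENNReal.ofReal (acceptProb U σ p.2 p.1 y) ∂proposal U σ p.2 p.1 := by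
  simp only [lintegral_proposal_acceptProb hU]
  exact Measurable.lintegral_prod_right
    (f := fun (p : E d × Stiefel d m) y => ENNReal.ofReal (propDensity U σ p.2 p.1 y) *
      ENNReal.ofReal (acceptProb U σ p.2 p.1 y))
    ((measurable_propDensity hU σ).ennreal_ofReal.mul (measurable_acceptProb hU σ).ennreal_ofReal)

/-- Exponential decay of the average acceptance rate given the directions `V`. -/
lemma lintegral_acceptProb_le [IsProbabilityMeasure π] (h : IsTarget L lam U π) (hlam : 0 < lam)
    {σ t w : ℝ} (hσ : 0 < σ) (ht : 0 ≤ t) (htlam : t ≤ lam / 4)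
    (hw : w = 2 * t * σ ^ 2 / (1 + 2 * t * σ ^ 2)) (V : Stiefel d m) :
    ∫⁻ x, ∫⁻ y, ENNReal.ofReal (acceptProb U σ V x y) ∂proposal U σ V x ∂π ≤
      2 * ENNReal.ofReal
        (Real.exp (-((freeCoords V).card * w / 2) + 2 * (t * w) * d / lam)) := by
  obtain ⟨a, ha⟩ := h.exists_isMin hlam
  have hU := h.contDiff.continuous.measurable
  have hq := measurable_propDensity_pair (m := m) h.contDiff σ V
  have hw0 : 0 ≤ w := by rw [hw]; positivity
  have hw1 : w ≤ 1 := by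
    rw [hw, div_le_one (by positivity)]; linarith
  let G : E d → E d → ℝ≥0∞ := fun x y =>
    ENNReal.ofReal (Real.exp (-U x)) *
      ENNReal.ofReal (propDensity U σ V x y * Real.exp (-(t * freeDrift V a x y)))
  have hdr : Measurable fun p : E d × E d => freeDrift V a p.1 p.2 := by
    unfold freeDrift
    fun_prop
  have hG : Measurable (Function.uncurry G) := by
    dsimp only [G, Function.uncurry_def]
    fun_prop
  have hGswap : ∫⁻ x, ∫⁻ y, G y x = ∫⁻ x, ∫⁻ y, G x y :=
    lintegral_lintegral_swap (f := fun x y => G y x) (hG.comp measurable_swap).aemeasurable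
  have hacc : Measurable fun x : E d =>
      ∫⁻ y, ENNReal.ofReal (acceptProb U σ V x y) ∂proposal U σ V x :=
    (measurable_lintegral_acceptProb (m := m) h.contDiff σ).comp
      (f := fun x : E d => (x, V)) (by fun_prop)
  -- The accepted flow is below both the forward and the backward flow; the one whose free drift is
  -- nonpositive has an exponential weight at least `1`.
  have hpt : ∀ x y, ENNReal.ofReal (Real.exp (-U x)) * (ENNReal.ofReal (propDensity U σ V x y) *
      ENNReal.ofReal (acceptProb U σ V x y)) ≤ G x y + G y x := by
    intro x y
    have hx := propDensity_pos U hσ V x y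
    have hy := propDensity_pos U hσ V y x
    have hex := Real.exp_pos (-U x)
    rw [← ENNReal.ofReal_mul hx.le, ← ENNReal.ofReal_mul hex.le]
    dsimp only [G]
    rw [← ENNReal.ofReal_mul hex.le, ← ENNReal.ofReal_mul (Real.exp_pos _).le]
    rcases le_total (freeDrift V a x y) 0 with hT | hT
    · refine le_add_right (ENNReal.ofReal_le_ofReal ?_)
      gcongr
      exact (acceptProb_le_one U σ V x y).trans
        (Real.one_le_exp (neg_nonneg.2 (mul_nonpos_of_nonneg_of_nonpos ht hT)))
    · refine le_add_left (ENNReal.ofReal_le_ofReal ?_)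
      have h1 : acceptProb U σ V x y ≤
          Real.exp (-U y) * propDensity U σ V y x / (Real.exp (-U x) * propDensity U σ V x y) :=
        min_le_right _ _
      rw [le_div_iff₀ (by positivity)] at h1
      have h2 : 1 ≤ Real.exp (-(t * freeDrift V a y x)) := by
        rw [freeDrift_swap]
        exact Real.one_le_exp (by linarith [mul_nonneg ht hT])
      calc Real.exp (-U x) * (propDensity U σ V x y * acceptProb U σ V x y)
          = acceptProb U σ V x y * (Real.exp (-U x) * propDensity U σ V x y) := by ring
        _ ≤ Real.exp (-U y) * propDensity U σ V y x := h1
        _ ≤ Real.exp (-U y) * propDensity U σ V y x * Real.exp (-(t * freeDrift V a y x)) :=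
            le_mul_of_one_le_right (by positivity) h2
        _ = _ := by ring
  have hGle : ∫⁻ x, ∫⁻ y, G x y ≤ ENNReal.ofReal
        (Real.exp (-((freeCoords V).card * w / 2) + 2 * (t * w) * d / lam)) := by
    calc ∫⁻ x, ∫⁻ y, G x y
        ≤ ∫⁻ x, ENNReal.ofReal (Real.exp (-U x)) *
          (ENNReal.ofReal (Real.exp (-((freeCoords V).card * w / 2))) *
            ENNReal.ofReal (Real.exp (t * w * ‖x - a‖ ^ 2))) := by
          refine lintegral_mono fun x => ?_
          dsimp only [G]
          rw [lintegral_const_mul' _ _ ENNReal.ofReal_ne_top,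
            ← ENNReal.ofReal_mul (Real.exp_pos _).le, ← Real.exp_add]
          exact mul_le_mul' le_rfl (lintegral_exp_freeDrift_le U hσ ht hw V a x)
      _ = ENNReal.ofReal (Real.exp (-((freeCoords V).card * w / 2))) *
            ∫⁻ x, ENNReal.ofReal (Real.exp (t * w * ‖x - a‖ ^ 2)) ∂π := by
          rw [h.lintegral_eq (by fun_prop), ← lintegral_const_mul' _ _ ENNReal.ofReal_ne_top]
          exact lintegral_congr fun x => by ring
      _ ≤ ENNReal.ofReal (Real.exp (-((freeCoords V).card * w / 2))) *
            ENNReal.ofReal (Real.exp (2 * (t * w) * d / lam)) :=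
          mul_le_mul' le_rfl (h.lintegral_exp_sq_norm_le hlam ha (by positivity)
            ((mul_le_of_le_one_right ht hw1).trans htlam))
      _ = _ := by rw [← ENNReal.ofReal_mul (Real.exp_pos _).le, ← Real.exp_add]
  calc ∫⁻ x, ∫⁻ y, ENNReal.ofReal (acceptProb U σ V x y) ∂proposal U σ V x ∂π
      = ∫⁻ x, ∫⁻ y, ENNReal.ofReal (Real.exp (-U x)) * (ENNReal.ofReal (propDensity U σ V x y) *
          ENNReal.ofReal (acceptProb U σ V x y)) := by
        rw [h.lintegral_eq hacc]
        refine lintegral_congr fun x => ?_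
        rw [lintegral_const_mul' _ _ ENNReal.ofReal_ne_top]
        rw [lintegral_proposal_acceptProb h.contDiff]
    _ ≤ ∫⁻ x, ∫⁻ y, (G x y + G y x) := lintegral_mono fun x => lintegral_mono fun y => hpt x y
    _ = 2 * ∫⁻ x, ∫⁻ y, G x y := by
        have h1 : ∀ x, Measurable (G x) := fun x => hG.comp measurable_prodMk_left
        have h2 : Measurable fun x => ∫⁻ y, G x y := Measurable.lintegral_prod_right hG
        simp only [lintegral_add_left (h1 _)]
        rw [lintegral_add_left h2, hGswap, two_mul]
    _ ≤ _ := mul_le_mul' le_rfl hGle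

/-- The gap decays exponentially in the dimension as soon as the steps are not too small. -/
lemma rightGap_smala_le_exp [IsProbabilityMeasure π] [NeZero d] (h : IsTarget L lam U π)
    (hlam : 0 < lam) {ν : Measure (Stiefel d m)} [IsProbabilityMeasure ν]
    (hν : CanonicalColumns ν) {κ σ w : ℝ} (hκ0 : 0 < κ) (hκ1 : κ ≤ 1) (hm : m ≤ (1 - κ) * d)
    (hσ : 0 < σ) (hw : w = lam * κ * σ ^ 2 / 4 / (1 + lam * κ * σ ^ 2 / 4)) :
    rightGap π (smala h.contDiff ν σ) ≤ ENNReal.ofReal (4 * Real.exp (-(κ * d * w / 4))) := by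
  refine (rightGap_smala_le_accept h ν σ).trans ?_
  rw [lintegral_lintegral_swap (measurable_lintegral_acceptProb h.contDiff σ).aemeasurable]
  have hw0 : 0 ≤ w := by rw [hw]; positivity
  have hV : ∀ᵐ V ∂ν, ∫⁻ x, ∫⁻ y, ENNReal.ofReal (acceptProb U σ V x y) ∂proposal U σ V x ∂π ≤
      2 * ENNReal.ofReal (Real.exp (-(κ * d * w / 4))) := by
    filter_upwards [hν] with V hV
    -- With this `t` the concentration cost `2 t w d / lam = κ d w / 4` is half of the gain `κ d w /
    -- 2` from the free coordinates.
    refine (lintegral_acceptProb_le h hlam (t := lam * κ / 8) (w := w) hσ (by positivity)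
      (by nlinarith) (by rw [hw]; ring_nf) V).trans ?_
    refine mul_le_mul' le_rfl (ENNReal.ofReal_le_ofReal (Real.exp_le_exp.2 ?_))
    have hcard : (d : ℝ) ≤ m + (freeCoords V).card := by exact_mod_cast le_card_freeCoords hV
    have h1 : κ * d ≤ (freeCoords V).card := by linarith
    have h2 := mul_le_mul_of_nonneg_right h1 hw0
    have e : 2 * (lam * κ / 8 * w) * d / lam = κ * d * w / 4 := by field_simp; ring
    rw [e]
    linarith
  calc 2 * ∫⁻ V, ∫⁻ x, ∫⁻ y, ENNReal.ofReal (acceptProb U σ V x y) ∂proposal U σ V x ∂π ∂ν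
      ≤ 2 * ∫⁻ _V, 2 * ENNReal.ofReal (Real.exp (-(κ * d * w / 4))) ∂ν :=
        mul_le_mul' le_rfl (lintegral_mono_ae hV)
    _ = _ := by
        rw [lintegral_const, measure_univ, mul_one, ← mul_assoc, ENNReal.ofReal_mul (by norm_num)]
        norm_num

end

/-! ### Small steps: the mean squared displacement. -/

section

/-- Superadditivity of the lower integral; this direction needs no measurability. -/
lemma sum_lintegral_le {α ι : Type*} [MeasurableSpace α] (ρ : Measure α) (s : Finset ι)
    (f : ι → α → ℝ≥0∞) : ∑ i ∈ s, ∫⁻ x, f i x ∂ρ ≤ ∫⁻ x, ∑ i ∈ s, f i x ∂ρ := by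
  classical
  induction s using Finset.induction_on with
  | empty => simp
  | insert i s hi ih =>
    simp only [Finset.sum_insert hi]
    exact (add_le_add le_rfl ih).trans (le_lintegral_add _ _)

lemma mul_transpose_apply_self (V : Stiefel d m) (i : Fin d) :
    (V.1 * V.1ᵀ) i i = ∑ k, V.1 i k ^ 2 := by
  simp [Matrix.mul_apply, sq]

lemma mul_transpose_apply_of_ne {V : Stiefel d m}
    (hV : ∀ j : Fin m, ∃ i : Fin d, V.1.col j = Pi.single i 1) {i j : Fin d} (hij : i ≠ j) :
    (V.1 * V.1ᵀ) i j = 0 := by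
  rw [Matrix.mul_apply]
  refine Finset.sum_eq_zero fun k _ => ?_
  obtain ⟨l, hl⟩ := hV k
  have h : ∀ i, V.1 i k = (Pi.single l 1 : Fin d → ℝ) i := fun i => congrFun hl i
  rw [Matrix.transpose_apply, h i, h j]
  by_cases hi : i = l
  · rw [Pi.single_eq_of_ne (i := l) (i' := j) (by rintro rfl; exact hij hi), mul_zero]
  · rw [Pi.single_eq_of_ne hi, zero_mul]

/-- `V Vᵀ` is a diagonal projection, so its diagonal entries equal their squares and the norm is
linear in them; isotropy then gives its mean. -/
lemma sq_norm_gradEst (U : E d → ℝ) {V : Stiefel d m}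
    (hV : ∀ j : Fin m, ∃ i : Fin d, V.1.col j = Pi.single i 1) (x : E d) :
    ‖gradEst U V x‖ ^ 2 =
      ((d : ℝ) / m) ^ 2 * ∑ i, (gradient U x) i ^ 2 * (V.1 * V.1ᵀ) i i := by
  set M := V.1 * V.1ᵀ with hM
  have hdiag : ∀ i, (M *ᵥ (gradient U x).ofLp) i = M i i * (gradient U x) i := by
    intro i
    rw [Matrix.mulVec, dotProduct, Finset.sum_eq_single i]
    · intro j _ hj
      rw [hM, mul_transpose_apply_of_ne hV hj.symm, zero_mul]
    · simp
  have hidem : M * M = M := by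
    rw [hM, Matrix.mul_assoc, ← Matrix.mul_assoc V.1ᵀ, V.2, Matrix.one_mul]
  have hsq : ∀ i, M i i * M i i = M i i := by
    intro i
    conv_rhs => rw [← hidem, Matrix.mul_apply]
    rw [Finset.sum_eq_single i]
    · intro j _ hj
      rw [hM, mul_transpose_apply_of_ne hV hj, mul_zero]
    · simp
  rw [gradEst, norm_smul, mul_pow, Real.norm_eq_abs, sq_abs, EuclideanSpace.norm_sq_eq]
  congr 1
  refine Finset.sum_congr rfl fun i _ => ?_
  rw [Real.norm_eq_abs, sq_abs]
  change (M *ᵥ (gradient U x).ofLp) i ^ 2 = _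
  rw [hdiag, mul_pow, sq, hsq]
  ring

/-- The second moment of the gradient estimator is inflated by a factor `d / m`. -/
lemma lintegral_sq_norm_gradEst (U : E d → ℝ) {ν : Measure (Stiefel d m)} [NeZero d]
    (hiso : IsIsotropic ν) (hν : CanonicalColumns ν) (x : E d) :
    ∫⁻ V, ENNReal.ofReal (‖gradEst U V x‖ ^ 2) ∂ν =
      ENNReal.ofReal ((d : ℝ) / m * ‖gradient U x‖ ^ 2) := by
  have hdm : ∀ i : Fin d, ((d : ℝ) / m) * ∫ V, (V.1 * V.1ᵀ) i i ∂ν = 1 := fun i => by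
    simpa using hiso i i
  have hMm : ∀ i : Fin d, Measurable fun V : Stiefel d m => (V.1 * V.1ᵀ) i i := fun i => by
    simp only [mul_transpose_apply_self]
    refine Finset.measurable_sum _ fun k _ => Measurable.pow_const ?_ 2
    exact (measurable_pi_apply k).comp ((measurable_pi_apply i).comp measurable_subtype_coe)
  have hM0 : ∀ (V : Stiefel d m) (i : Fin d), 0 ≤ (V.1 * V.1ᵀ) i i := fun V i => by
    rw [mul_transpose_apply_self]
    positivity
  have hint : ∀ i : Fin d, ENNReal.ofReal ((d : ℝ) / m) *
      ∫⁻ V, ENNReal.ofReal ((V.1 * V.1ᵀ) i i) ∂ν = 1 := by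
    intro i
    have hi : Integrable (fun V : Stiefel d m => (V.1 * V.1ᵀ) i i) ν := by
      -- Without integrability the Bochner integral would be `0`, and isotropy would read `0 = 1`.
      by_contra hni
      have := hdm i
      rw [integral_undef hni] at this
      simp at this
    rw [← ofReal_integral_eq_lintegral_ofReal hi (ae_of_all _ fun V => hM0 V i),
      ← ENNReal.ofReal_mul (by positivity), hdm i, ENNReal.ofReal_one]
  have hae : ∀ᵐ V ∂ν, ENNReal.ofReal (‖gradEst U V x‖ ^ 2) =
      ENNReal.ofReal (((d : ℝ) / m) ^ 2) *
        ∑ i, ENNReal.ofReal ((gradient U x) i ^ 2) * ENNReal.ofReal ((V.1 * V.1ᵀ) i i) := by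
    filter_upwards [hν] with V hV
    rw [sq_norm_gradEst U hV, ENNReal.ofReal_mul (by positivity), ENNReal.ofReal_sum_of_nonneg
      fun i _ => mul_nonneg (sq_nonneg _) (hM0 V i)]
    simp only [ENNReal.ofReal_mul (sq_nonneg ((gradient U x).ofLp _))]
  rw [lintegral_congr_ae hae, lintegral_const_mul' _ _ ENNReal.ofReal_ne_top,
    lintegral_finsetSum _ fun i _ => (hMm i).ennreal_ofReal.const_mul _]
  simp only [lintegral_const_mul' _ _ ENNReal.ofReal_ne_top]
  rw [sq, ENNReal.ofReal_mul (by positivity), mul_assoc, Finset.mul_sum,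
    ENNReal.ofReal_mul (by positivity)]
  congr 1
  rw [EuclideanSpace.norm_sq_eq, ENNReal.ofReal_sum_of_nonneg fun i _ => by positivity]
  refine Finset.sum_congr rfl fun i _ => ?_
  rw [mul_left_comm, hint, mul_one, Real.norm_eq_abs, sq_abs]

variable {L : ℝ≥0} {lam : ℝ} {U : E d → ℝ} {π : Measure (E d)}

/-- Mean squared displacement of the proposals. -/
lemma lintegral_sq_norm_sub_le [IsProbabilityMeasure π] [NeZero d] (h : IsTarget L lam U π)
    (hlam : 0 < lam) {ν : Measure (Stiefel d m)} [IsProbabilityMeasure ν]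
    (hiso : IsIsotropic ν) (hν : CanonicalColumns ν) {σ : ℝ} (hσ : 0 < σ) :
    ∫⁻ x, ∫⁻ V, ∫⁻ y, ENNReal.ofReal (‖x - y‖ ^ 2) ∂proposal U σ V x ∂ν ∂π ≤
      ENNReal.ofReal (d * (12 * σ ^ 2 + 3 * σ ^ 4 * d * L ^ 2 / lam)) := by
  obtain ⟨a, ha⟩ := h.exists_isMin hlam
  have hd : (1 : ℝ) ≤ d := by exact_mod_cast Nat.pos_of_ne_zero (NeZero.ne d)
  have hdm : (d : ℝ) / m ≤ d := by
    rcases Nat.eq_zero_or_pos m with rfl | hm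
    · simp
    · exact div_le_self (by positivity) (by exact_mod_cast hm)
  have hy : ∀ (x : E d) (V : Stiefel d m),
      ∫⁻ y, ENNReal.ofReal (‖x - y‖ ^ 2) ∂proposal U σ V x ≤
        ENNReal.ofReal (12 * σ ^ 2 * d) +
          ENNReal.ofReal (σ ^ 4 / 2) * ENNReal.ofReal (‖gradEst U V x‖ ^ 2) := by
    intro x V
    have := isProbabilityMeasure_proposal U hσ V x
    set g := (σ ^ 2 / 2) • gradEst U V x with hg
    have hgn : 2 * ‖g‖ ^ 2 = σ ^ 4 / 2 * ‖gradEst U V x‖ ^ 2 := by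
      rw [hg, norm_smul, mul_pow, Real.norm_eq_abs, sq_abs]; ring
    calc ∫⁻ y, ENNReal.ofReal (‖x - y‖ ^ 2) ∂proposal U σ V x
        ≤ ∫⁻ y, (ENNReal.ofReal 2 * ENNReal.ofReal (‖y - (x - g)‖ ^ 2) +
            ENNReal.ofReal (2 * ‖g‖ ^ 2)) ∂proposal U σ V x := by
          refine lintegral_mono fun y => ?_
          rw [← ENNReal.ofReal_mul (by norm_num), ← ENNReal.ofReal_add (by positivity)
            (by positivity)]
          refine ENNReal.ofReal_le_ofReal ?_
          have e : x - y = g - (y - (x - g)) := by abel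
          have hn := norm_sub_le g (y - (x - g))
          rw [← e] at hn
          have := pow_le_pow_left₀ (norm_nonneg _) hn 2
          nlinarith [sq_nonneg (‖g‖ - ‖y - (x - g)‖)]
      _ = ENNReal.ofReal 2 * ∫⁻ y, ENNReal.ofReal (‖y - (x - g)‖ ^ 2) ∂proposal U σ V x +
            ENNReal.ofReal (2 * ‖g‖ ^ 2) := by
          rw [lintegral_add_right _ measurable_const,
            lintegral_const_mul' _ _ ENNReal.ofReal_ne_top]
          simp
      _ ≤ _ := by
          refine add_le_add ?_ ?_
          · refine (mul_le_mul' le_rfl (lintegral_sq_norm_sub_mean_le U hσ V x)).trans ?_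
            rw [← ENNReal.ofReal_mul (by norm_num)]
            refine ENNReal.ofReal_le_ofReal ?_
            nlinarith [sq_nonneg σ]
          · rw [hgn, ENNReal.ofReal_mul (by positivity)]
  have hV : ∀ x : E d, ∫⁻ V, ∫⁻ y, ENNReal.ofReal (‖x - y‖ ^ 2) ∂proposal U σ V x ∂ν ≤
      ENNReal.ofReal (12 * σ ^ 2 * d) +
        ENNReal.ofReal (σ ^ 4 / 2 * (d * L ^ 2)) * ENNReal.ofReal (‖x - a‖ ^ 2) := by
    intro x
    refine (lintegral_mono fun V => hy x V).trans ?_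
    rw [lintegral_add_left measurable_const, lintegral_const_mul' _ _ ENNReal.ofReal_ne_top,
      lintegral_sq_norm_gradEst U hiso hν, lintegral_const, measure_univ, mul_one]
    refine add_le_add le_rfl ?_
    rw [← ENNReal.ofReal_mul (by positivity), ← ENNReal.ofReal_mul (by positivity), mul_assoc]
    refine ENNReal.ofReal_le_ofReal (mul_le_mul_of_nonneg_left ?_ (by positivity))
    have hg := pow_le_pow_left₀ (norm_nonneg _) (h.norm_gradient_le ha x) 2
    calc (d : ℝ) / m * ‖gradient U x‖ ^ 2 ≤ d * (L * ‖x - a‖) ^ 2 := by gcongr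
      _ = _ := by ring
  refine (lintegral_mono hV).trans ?_
  rw [lintegral_add_left measurable_const, lintegral_const_mul' _ _ ENNReal.ofReal_ne_top,
    lintegral_const, measure_univ, mul_one]
  refine (add_le_add le_rfl (mul_le_mul' le_rfl (h.lintegral_sq_norm_le hlam ha))).trans ?_
  rw [← ENNReal.ofReal_mul (by positivity), ← ENNReal.ofReal_add (by positivity) (by positivity)]
  refine ENNReal.ofReal_le_ofReal ?_
  have h1 : σ ^ 4 / 2 * (d * L ^ 2) * (4 / lam * (d / 2 + 1)) ≤
      σ ^ 4 / 2 * (d * L ^ 2) * (4 / lam * (d / 2 + d)) := by gcongr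
  have e : σ ^ 4 / 2 * (d * L ^ 2) * (4 / lam * (d / 2 + d)) =
      d * (3 * σ ^ 4 * d * L ^ 2 / lam) := by ring
  rw [e] at h1
  linarith

/-- The gap is at most of the order of the mean squared displacement per coordinate. -/
lemma rightGap_smala_le_sq [IsProbabilityMeasure π] [NeZero d] (h : IsTarget L lam U π)
    (hlam : 0 < lam) {ν : Measure (Stiefel d m)} [IsProbabilityMeasure ν]
    (hiso : IsIsotropic ν) (hν : CanonicalColumns ν) {σ : ℝ} (hσ : 0 < σ) :
    rightGap π (smala h.contDiff ν σ) ≤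
      ENNReal.ofReal ((12 * σ ^ 2 + 3 * σ ^ 4 * d * L ^ 2 / lam) /
        (2 * (Real.exp (-L) / (1 + Real.exp (-L))))) := by
  have hd : (0 : ℝ) < d := by exact_mod_cast Nat.pos_of_ne_zero (NeZero.ne d)
  set v := Real.exp (-(L : ℝ)) / (1 + Real.exp (-L)) with hv
  have hv0 : 0 < v := by positivity
  set Γ := rightGap π (smala h.contDiff ν σ) with hΓ
  -- Acceptance is bounded by `1`, so the Dirichlet form of a coordinate is at most its mean squared
  -- proposed displacement.
  have hcoord : ∀ i : Fin d, Γ * ENNReal.ofReal (2 * v) ≤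
      ∫⁻ x, ∫⁻ V, ∫⁻ y, ENNReal.ofReal ((x i - y i) ^ 2) ∂proposal U σ V x ∂ν ∂π := by
    intro i
    have hvar := h.le_variance_coord hlam i
    have h1 := rightGap_le (smala h.contDiff ν σ) (h.memLp_coord hlam i) (hv0.trans_le hvar)
    have h2 := ENNReal.mul_le_of_le_div h1
    refine le_trans ?_ (h2.trans ?_)
    · gcongr
    · refine lintegral_mono fun x => ?_
      rw [lintegral_smala h.contDiff ν σ (F := fun y => ENNReal.ofReal ((x i - y i) ^ 2))
        (by fun_prop) (by simp)]
      refine lintegral_mono fun V => lintegral_mono fun y => ?_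
      exact mul_le_of_le_one_left' (ENNReal.ofReal_le_one.2 (acceptProb_le_one U σ V x y))
  have hsum : d * (Γ * ENNReal.ofReal (2 * v)) ≤
      ENNReal.ofReal (d * (12 * σ ^ 2 + 3 * σ ^ 4 * d * L ^ 2 / lam)) := by
    calc d * (Γ * ENNReal.ofReal (2 * v)) = ∑ _i : Fin d, Γ * ENNReal.ofReal (2 * v) := by simp
      _ ≤ ∑ i, ∫⁻ x, ∫⁻ V, ∫⁻ y, ENNReal.ofReal ((x i - y i) ^ 2) ∂proposal U σ V x ∂ν ∂π :=
          Finset.sum_le_sum fun i _ => hcoord i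
      _ ≤ ∫⁻ x, ∫⁻ V, ∫⁻ y, ∑ i, ENNReal.ofReal ((x i - y i) ^ 2) ∂proposal U σ V x ∂ν ∂π := by
          refine (sum_lintegral_le _ _ _).trans (lintegral_mono fun x => ?_)
          exact (sum_lintegral_le _ _ _).trans (lintegral_mono fun V => sum_lintegral_le _ _ _)
      _ = ∫⁻ x, ∫⁻ V, ∫⁻ y, ENNReal.ofReal (‖x - y‖ ^ 2) ∂proposal U σ V x ∂ν ∂π := by
          simp only [← ENNReal.ofReal_sum_of_nonneg fun (i : Fin d) _ => sq_nonneg (_ : ℝ),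
            EuclideanSpace.norm_sq_eq, Real.norm_eq_abs, sq_abs, PiLp.sub_apply]
      _ ≤ _ := lintegral_sq_norm_sub_le h hlam hiso hν hσ
  rw [← mul_div_mul_left _ _ hd.ne', ENNReal.ofReal_div_of_pos (by positivity),
    ENNReal.ofReal_mul (q := 2 * v) hd.le, ENNReal.ofReal_natCast,
    ENNReal.le_div_iff_mul_le (by simp [hv0, NeZero.ne d]) (by left; finiteness)]
  calc Γ * (d * ENNReal.ofReal (2 * v)) = d * (Γ * ENNReal.ofReal (2 * v)) := by ring
    _ ≤ _ := hsum

end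

/-! ### Balancing the two bounds over the step size. -/

/-- The spectral gap is `O (log d ^ 2 / d)` uniformly over the step size, the target and the
distribution of the directions, when a proportion `κ` of the coordinates is left free. -/
lemma exists_rightGap_smala_le (L : ℝ≥0) {lam : ℝ} (hlam : 0 < lam) {κ : ℝ} (hκ0 : 0 < κ)
    (hκ1 : κ ≤ 1) :
    ∃ C : ℝ, 0 < C ∧ ∀ᶠ d : ℕ in Filter.atTop, ∀ (m : ℕ) (U : E d → ℝ) (π : Measure (E d))
      [IsProbabilityMeasure π] (h : IsTarget L lam U π) (ν : Measure (Stiefel d m))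
      [IsProbabilityMeasure ν], IsIsotropic ν → CanonicalColumns ν → m ≤ (1 - κ) * d →
      ∀ σ : ℝ, 0 < σ →
        rightGap π (smala h.contDiff ν σ) ≤ ENNReal.ofReal (C * (Real.log d ^ 2 / d)) := by
  set v := Real.exp (-(L : ℝ)) / (1 + Real.exp (-L)) with hv
  have hv0 : 0 < v := by positivity
  set K := 32 / (lam * κ ^ 2) with hK
  have hK0 : 0 < K := by positivity
  set C₁ := (12 * K + 3 * K ^ 2 * L ^ 2 / lam) / (2 * v) with hC₁
  have hC₁0 : 0 < C₁ := by positivity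
  refine ⟨4 + C₁, by positivity, ?_⟩
  have hlog : Filter.Tendsto (fun d : ℕ => Real.log d) Filter.atTop Filter.atTop :=
    Real.tendsto_log_atTop.comp tendsto_natCast_atTop_atTop
  have hsmall : Filter.Tendsto (fun d : ℕ => Real.log d / d) Filter.atTop (nhds 0) :=
    (Real.isLittleO_log_id_atTop.tendsto_div_nhds_zero).comp tendsto_natCast_atTop_atTop
  filter_upwards [hlog.eventually_ge_atTop 1, Filter.eventually_ge_atTop 1,
    hsmall.eventually_le_const (by positivity : 0 < κ / 8)] with d hl hd1 hls
  intro m U π _ h ν _ hiso hν hm σ hσ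
  have : NeZero d := ⟨by omega⟩
  have hd : (0 : ℝ) < d := by exact_mod_cast hd1
  set s := lam * κ * σ ^ 2 / 4 with hs
  have hs0 : 0 < s := by positivity
  set w := s / (1 + s) with hw
  have hl2 : Real.log d ≤ Real.log d ^ 2 := by nlinarith
  -- Above this threshold `exp (-(κ d w / 4)) ≤ 1 / d`. Below it `w ≤ 1/2`, hence `s ≤ 2 w`, and
  -- solving for `σ²` produces `K`.
  rcases le_total (4 * Real.log d / (κ * d)) w with hcase | hcase
  · refine (rightGap_smala_le_exp h hlam hν hκ0 hκ1 hm hσ hw).trans (ENNReal.ofReal_le_ofReal ?_)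
    rw [div_le_iff₀ (by positivity)] at hcase
    have h1 : Real.exp (-(κ * d * w / 4)) ≤ 1 / d := by
      rw [one_div, ← Real.exp_log hd, ← Real.exp_neg, Real.exp_log hd, Real.exp_le_exp]
      linarith
    calc 4 * Real.exp (-(κ * d * w / 4)) ≤ 4 * (1 / d) := by gcongr
      _ ≤ (4 + C₁) * (Real.log d ^ 2 / d) := by
          gcongr
          · linarith
          · linarith
  · refine (rightGap_smala_le_sq h hlam hiso hν hσ).trans (ENNReal.ofReal_le_ofReal ?_)
    have hσK : σ ^ 2 ≤ K * (Real.log d / d) := by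
      have e : 4 * Real.log d / (κ * d) = 4 / κ * (Real.log d / d) := by field_simp
      rw [e] at hcase
      have hw2 : w ≤ 1 / 2 := by
        refine hcase.trans ?_
        calc 4 / κ * (Real.log d / d) ≤ 4 / κ * (κ / 8) := by gcongr
          _ = 1 / 2 := by field_simp; norm_num
      have hs1 : s ≤ 1 := by
        rw [hw, div_le_iff₀ (by positivity)] at hw2
        linarith
      have hsw : s ≤ 2 * w := by
        rw [hw, ← mul_div_assoc, le_div_iff₀ (by positivity)]
        nlinarith
      have e2 : σ ^ 2 = 4 / (lam * κ) * s := by rw [hs]; field_simp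
      have e3 : K * (Real.log d / d) = 4 / (lam * κ) * (2 * (4 / κ * (Real.log d / d))) := by
        rw [hK]; field_simp; norm_num
      rw [e2, e3]
      gcongr
      linarith
    have hσ4 : σ ^ 4 * d ≤ K ^ 2 * (Real.log d ^ 2 / d) := by
      calc σ ^ 4 * d = (σ ^ 2) ^ 2 * d := by ring
        _ ≤ (K * (Real.log d / d)) ^ 2 * d := by gcongr
        _ = _ := by field_simp
    have hσ2 : σ ^ 2 ≤ K * (Real.log d ^ 2 / d) := hσK.trans (by gcongr)
    calc (12 * σ ^ 2 + 3 * σ ^ 4 * d * L ^ 2 / lam) / (2 * v)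
        = (12 * σ ^ 2 + 3 * (σ ^ 4 * d) * L ^ 2 / lam) / (2 * v) := by ring
      _ ≤ (12 * (K * (Real.log d ^ 2 / d)) +
            3 * (K ^ 2 * (Real.log d ^ 2 / d)) * L ^ 2 / lam) / (2 * v) := by gcongr
      _ = C₁ * (Real.log d ^ 2 / d) := by rw [hC₁]; ring
      _ ≤ _ := by gcongr; linarith

end ZOMala

end

open ZOMala
theorem theorem3p1 (L : NNReal) (lam : ℝ) (hlam : 0 < lam) (c₀ : ℝ) (hc₀ : c₀ ∈ Set.Ioo (0 : ℝ) 1) :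
    ∃ (C : ℝ) (d₀ : ℕ), 0 < C ∧
      ∀ (d m : ℕ), d₀ ≤ d → (m : ℝ) < c₀ * d →
      ∀ (U : E d → ℝ) (π : Measure (E d)) [IsProbabilityMeasure π] (hπ : IsTarget L lam U π)
        (ν : Measure (Stiefel d m)) [IsProbabilityMeasure ν],
        IsIsotropic ν → CanonicalColumns ν →
        (⨆ (σ : ℝ) (_ : 0 < σ), rightGap π (smala hπ.contDiff ν σ)) ≤
            ENNReal.ofReal (C * (Real.log ((d : ℝ) - m) ^ 2 / ((d : ℝ) - m))) ∧
        (⨆ (σ : ℝ) (_ : 0 < σ), rightGap π (smala hπ.contDiff ν σ)) ≤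
            ENNReal.ofReal (C * (Real.log d ^ 2 / d)) := by
  obtain ⟨hc0, hc1⟩ := hc₀
  have hκ0 : 0 < 1 - c₀ := by linarith
  obtain ⟨C, hC, hgap⟩ := exists_rightGap_smala_le L hlam hκ0 (by linarith)
  have hlog : Filter.Tendsto (fun d : ℕ => Real.log d) Filter.atTop Filter.atTop :=
    Real.tendsto_log_atTop.comp tendsto_natCast_atTop_atTop
  obtain ⟨d₁, hd₁⟩ := Filter.eventually_atTop.1 (hgap.and
    ((hlog.eventually_ge_atTop (-2 * Real.log (1 - c₀))).and (Filter.eventually_ge_atTop 1)))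
  refine ⟨4 * C, d₁, by positivity, fun d m hd hm U π _ hπ ν _ hiso hν => ?_⟩
  obtain ⟨h1, h2, h3⟩ := hd₁ d hd
  have hd0 : (1 : ℝ) ≤ d := by exact_mod_cast h3
  have hlogd : 0 ≤ Real.log d := Real.log_nonneg hd0
  have hmd : (1 - c₀) * d ≤ d - m := by linarith
  have hmd0 : 0 < (1 - c₀) * d := by positivity
  -- Since `d - m ≥ (1 - c₀) d`, the loss `-log (1 - c₀)` is at most half of `log d` for large `d`.
  -- Squaring the factor `2` gives the constant `4 * C`.
  have hlogm : Real.log d ≤ 2 * Real.log ((d : ℝ) - m) := by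
    have := Real.log_le_log hmd0 hmd
    rw [Real.log_mul hκ0.ne' (by positivity)] at this
    linarith
  have hsup : (⨆ (σ : ℝ) (_ : 0 < σ), rightGap π (smala hπ.contDiff ν σ)) ≤
      ENNReal.ofReal (C * (Real.log d ^ 2 / d)) :=
    iSup₂_le fun σ hσ => h1 m U π hπ ν hiso hν (by linarith) σ hσ
  refine ⟨hsup.trans (ENNReal.ofReal_le_ofReal ?_), hsup.trans (ENNReal.ofReal_le_ofReal ?_)⟩
  · have h4 : Real.log d ^ 2 ≤ (2 * Real.log ((d : ℝ) - m)) ^ 2 :=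
      pow_le_pow_left₀ hlogd hlogm 2
    calc C * (Real.log d ^ 2 / d) ≤ C * ((2 * Real.log ((d : ℝ) - m)) ^ 2 / (d - m)) := by
          gcongr
          · linarith
          · linarith [Nat.cast_nonneg (α := ℝ) m]
      _ = _ := by ring
  · have : 0 ≤ C * (Real.log d ^ 2 / d) := by positivity
    linarith
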